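/- The following is a theorem of intuitionistic analysis; read classically it is false. All logical constants are understood intuitionistically. $\mathcal N$ is the set of infinite sequences $\alpha:\mathbb N\to\mathbb N$. Fix a bijective coding $\langle\ \rangle$ of the finite sequences of natural numbers by natural numbers, with $\langle\,\rangle=0$, and put $J(n,s)=\langle n\rangle\ast s$; $\overline\alpha n$ is the code of $(\alpha(0),\dots,\alpha(n-1))$, $\alpha^n$ is the sequence $j\mapsto\alpha(J(n,j))$, and $\underline 0$ is the sequence that is constantly $0$. The axioms that are used are the First and Second Axiom of Countable Choice (for relations $R\subseteq\mathbb N\times\mathbb N$ and $R\subseteq\mathbb N\times\mathcal N$) and Brouwer's Continuity Principle: for every $R\subseteq\mathcal N\times\mathbb N$, if $\forall\alpha\exists n[\alpha Rn]$, then $\forall\alpha\exists m\exists n\forall\beta[\overline\beta m=\overline\alpha m\rightarrow\beta Rn]$. *Definitions.* The set of *stumps* is the least subset of $\mathcal N$ that contains every $\beta$ with $\beta(0)\neq0$ (an *empty* stump), and every $\beta$ with $\beta(0)=0$ all of whose subsequences $\beta^n$ it contains. By simultaneous induction, $\sigma\le\tau$ iff $\sigma$ is empty or $\sigma$ is non-empty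 and $\sigma^n<\tau$ for all $n$; and $\sigma<\tau$ iff $\tau$ is non-empty and $\sigma\le\tau^n$ for some $n$. Put $CB^\ast_\sigma=\{\underline0\}$ if $\sigma$ is empty, and $CB^\ast_\sigma=\{\underline0\}\cup\bigcup_{n}\,\overline{\underline 0}n\ast\langle1\rangle\ast CB^\ast_{\sigma^n}$ if $\sigma$ is non-empty. For $X\subseteq\mathcal N$, $\overline X$ is the set of all $\alpha$ such that for each $n$ some $\beta\in X$ has $\overline\beta n=\overline\alpha n$, and $\mathit{Share}(X)$ is the set of all $\beta$ such that, for some $\alpha\in X$, $\beta(\overline\alpha n)=0$ for all $n$. A sequence $\gamma$ *codes a continuous function* $\mathcal N\to\mathcal N$ iff for all $n,\alpha$ there is $k$ with $\gamma^n(\overline\alpha k)\neq0$; then $(\gamma|\alpha)(n)=\gamma^n(\overline\alpha k)-1$ for the least such $k$. $X$ *reduces to* $Y$ iff there is such a $\gamma$ with, for all $\alpha$, $\alpha\in X\leftrightarrow\gamma|\alpha\in Y$. $D^n(X)=\{\alpha:\exists i<n\,[\alpha^i\in X]\}$ and $C^n(X)=\{\alpha:\forall i<n\,[\alpha^i\in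 X]\}$. $X$ is *disjunctively productive* iff for each $n$ the set $D^{n+1}(X)$ does not reduce to $D^n(X)$, and *conjunctively productive* iff for each $n$ the set $C^{n+1}(X)$ does not reduce to $C^n(X)$. *Theorem.* For every stump $\sigma$ there exists a stump $\tau$ such that $\sigma<\tau$ and each of the two sets $\mathit{Share}(CB^\ast_\tau)$ and $\mathit{Share}(\overline{CB^\ast_\tau})$ is both disjunctively and conjunctively productive. *Precise meaning.* Let $H$ be any complete Heyting algebra, and let there be given a collection of objects ("elements of $\mathcal N$") together with truth values $[\![\alpha(n)=m]\!]\in H$ ($n,m\in\mathbb N$) such that $\bigvee_m[\![\alpha(n)=m]\!]=\top$ and $[\![\alpha(n)=m]\!]\wedge[\![\alpha(n)=m']\!]=\bot$ for $m\ne m'$. Interpret the connectives and the quantifiers over $\mathbb N$ (the standard natural numbers) and over $\mathcal N$ by the operations of $H$, and inductively defined sets and relations as the least $H$-valued ones with the stated closure properties. If the three axioms above hold for all relations (with parameters from $\mathcal N$) that are definable from $\alpha(n)=m$ by $\bot$, $\wedge$, $\vee$, $\rightarrow$ and quantification over $\mathbb N$ (conjunctions and disjunctions of arbitrary sequences of formulas)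 and over $\mathcal N$, then the Theorem has truth value $\top$. -/

import Mathlib

/-!
Intuitionistic analysis, read in an arbitrary complete Heyting algebra of truth values.

The result is a theorem of intuitionistic analysis and is false when it is read classically.
Logical constants are therefore interpreted in a complete Heyting algebra `H` (a frame):
`⊓`, `⊔`, `⇨`, `ᶜ`, `⨅`, `⨆` stand for "and", "or", "implies", "not", "for all", "there exists".
The natural numbers are the usual ones. The elements of Baire space are the objects of
a domain `Elem`, about which nothing is assumed except the axioms of intuitionistic analysis
that are listed below. A statement holds in the interpretation if its truth value is `⊤`.
-/

universe u v

/-- A bijective coding of finite sequences of natural numbers; the empty sequence has code `0`. -/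
def seqCode : List ℕ → ℕ
  | [] => 0
  | n :: l => Nat.pair n (seqCode l) + 1

/-- The pairing function `J(n, s) = ⟨n⟩ ∗ s`; its range is `ℕ \ {0}`. -/
def pairJ (n s : ℕ) : ℕ := Nat.pair n s + 1

theorem seqCode_cons (n : ℕ) (l : List ℕ) : seqCode (n :: l) = pairJ n (seqCode l) := rfl

theorem seqCode_bijective : Function.Bijective seqCode := by
  constructor
  · intro l
    induction l with
    | nil => intro l' h; cases l' with
      | nil => rfl
      | cons a l' => simp [seqCode] at h
    | cons a l ih => intro l' h; cases l' with
      | nil => simp [seqCode] at h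
      | cons b l' =>
        simp only [seqCode, Nat.add_right_cancel_iff, Nat.pair_eq_pair] at h
        rw [h.1, ih h.2]
  · intro s
    induction s using Nat.strong_induction_on with
    | _ s ih =>
      cases s with
      | zero => exact ⟨[], rfl⟩
      | succ s =>
        obtain ⟨l, hl⟩ := ih (Nat.unpair s).2 (Nat.lt_succ_of_le (Nat.unpair_right_le s))
        exact ⟨(Nat.unpair s).1 :: l, by rw [seqCode, hl, Nat.pair_unpair]⟩

/-- An interpretation of Baire space with truth values in `H`: the objects are infinite sequences
of natural numbers, and `val α n m` is the truth value of `α(n) = m`. -/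
structure BaireInterp (H : Type u) [Order.Frame H] where
  /-- the sequences -/
  Elem : Type v
  /-- the truth value of `α(n) = m` -/
  val : Elem → ℕ → ℕ → H
  val_total : ∀ α n, ⨆ m, val α n m = ⊤
  val_unique : ∀ α n m m', m ≠ m' → val α n m ⊓ val α n m' = ⊥

namespace BaireInterp

variable {H : Type u} [Order.Frame H] (M : BaireInterp.{u, v} H)

/-! ### Basic notions -/

/-- `α(n) ≠ 0`. -/
def nonzero (α : M.Elem) (n : ℕ) : H := ⨆ p, M.val α n (p + 1)

/-- `α` and `β` have the same initial part of length `m`. -/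
def agree (m : ℕ) (α β : M.Elem) : H := ⨅ i : Fin m, ⨆ p, M.val α i p ⊓ M.val β i p

/-- `α` passes through the finite sequence `l`: `l` is the initial part of `α` of its length. -/
def passes (α : M.Elem) (l : List ℕ) : H := ⨅ i : Fin l.length, M.val α i (l.get i)

/-- `α = 0, 0, 0, …`. -/
def isZero (α : M.Elem) : H := ⨅ n, M.val α n 0

/-- `ρ = α^n`, the `n`-th subsequence of `α`: for all `j`, `ρ(j) = α(J(n, j))`. -/
def isSub (α : M.Elem) (n : ℕ) (ρ : M.Elem) : H :=
  ⨅ j, ⨆ p, M.val α (pairJ n j) p ⊓ M.val ρ j p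

/-- `α^n` belongs to `X`. -/
def subMem (X : M.Elem → H) (α : M.Elem) (n : ℕ) : H := ⨆ ρ, M.isSub α n ρ ⊓ X ρ

/-- `α = 0^n ∗ ⟨1⟩ ∗ β`. -/
def isShift (n : ℕ) (β α : M.Elem) : H :=
  (⨅ i : Fin n, M.val α i 0) ⊓ M.val α n 1 ⊓ ⨅ j, ⨆ p, M.val β j p ⊓ M.val α (n + 1 + j) p

/-- `β` admits `α`: for each `n`, `β` has the value `0` at the code of the initial part of `α`
of length `n`. -/
def admits (β α : M.Elem) : H := ⨅ l : List ℕ, M.passes α l ⇨ M.val β (seqCode l) 0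

/-! ### The axioms of intuitionistic analysis -/

/-- The relations to which the axiom schemes apply: those definable from `α(n) = m`, with
parameters, by `⊥`, `∧`, `∨`, `→` and quantification over the natural numbers and over Baire
space. The argument `k` is the number of free sequence variables. -/
inductive Definable : (k : ℕ) → ((Fin k → M.Elem) → H) → Prop
  | val {k : ℕ} (i : Fin k) (n m : ℕ) : Definable k (fun x => M.val (x i) n m)
  | bot {k : ℕ} : Definable k (fun _ => ⊥)
  | and {k : ℕ} {φ ψ : (Fin k → M.Elem) → H} :
      Definable k φ → Definable k ψ → Definable k (fun x => φ x ⊓ ψ x)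
  | or {k : ℕ} {φ ψ : (Fin k → M.Elem) → H} :
      Definable k φ → Definable k ψ → Definable k (fun x => φ x ⊔ ψ x)
  | imp {k : ℕ} {φ ψ : (Fin k → M.Elem) → H} :
      Definable k φ → Definable k ψ → Definable k (fun x => φ x ⇨ ψ x)
  | allNat {k : ℕ} {φ : ℕ → (Fin k → M.Elem) → H} :
      (∀ n, Definable k (φ n)) → Definable k (fun x => ⨅ n, φ n x)
  | exNat {k : ℕ} {φ : ℕ → (Fin k → M.Elem) → H} :
      (∀ n, Definable k (φ n)) → Definable k (fun x => ⨆ n, φ n x)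
  | all {k : ℕ} {φ : (Fin (k + 1) → M.Elem) → H} :
      Definable (k + 1) φ → Definable k (fun x => ⨅ α, φ (Fin.cons α x))
  | ex {k : ℕ} {φ : (Fin (k + 1) → M.Elem) → H} :
      Definable (k + 1) φ → Definable k (fun x => ⨆ α, φ (Fin.cons α x))

/-- First axiom of countable choice: if for every `m` there is `n` such that `m R n`, then there
is `α` such that, for every `m`, `m R α(m)`. -/
def AC00 : Prop :=
  ∀ (k : ℕ) (R : ℕ → ℕ → (Fin k → M.Elem) → H), (∀ m n, M.Definable k (R m n)) →
    ∀ x, (⨅ m, ⨆ n, R m n x) ≤ ⨆ α, ⨅ m, ⨆ n, M.val α m n ⊓ R m n x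

/-- Second axiom of countable choice: if for every `m` there is `α` such that `m R α`, then there
is `δ` such that, for every `m`, `m R δ^m`. -/
def AC01 : Prop :=
  ∀ (k : ℕ) (R : ℕ → (Fin (k + 1) → M.Elem) → H), (∀ m, M.Definable (k + 1) (R m)) →
    ∀ x, (⨅ m, ⨆ α, R m (Fin.cons α x)) ≤
      ⨆ δ, ⨅ m, M.subMem (fun α => R m (Fin.cons α x)) δ m

/-- Brouwer's continuity principle: if for every `α` there is `n` such that `α R n`, then for
every `α` there are `m`, `n` such that `β R n` for every `β` that has the same initial part of
length `m` as `α`. -/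
def BCP : Prop :=
  ∀ (k : ℕ) (R : ℕ → (Fin (k + 1) → M.Elem) → H), (∀ n, M.Definable (k + 1) (R n)) →
    ∀ x, (⨅ α, ⨆ n, R n (Fin.cons α x)) ≤
      ⨅ α, ⨆ m, ⨆ n, ⨅ β, M.agree m α β ⇨ R n (Fin.cons β x)

/-- The interpretation satisfies the axioms of countable choice and Brouwer's continuity
principle. -/
structure IsBrouwerian : Prop where
  ac00 : M.AC00
  ac01 : M.AC01
  bcp : M.BCP

/-! ### Stumps -/

/-- `Q` contains every `β` with `β(0) ≠ 0`, and every `β` with `β(0) = 0` all of whose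
subsequences `β^n` are in `Q`. -/
def StumpClosed (Q : M.Elem → H) : Prop :=
  (∀ β, M.nonzero β 0 ≤ Q β) ∧ (∀ β, M.val β 0 0 ⊓ (⨅ n, M.subMem Q β n) ≤ Q β)

/-- The set of stumps: the least set with these closure properties. -/
def Stp (σ : M.Elem) : H := ⨅ Q : M.Elem → H, ⨅ _ : M.StumpClosed Q, Q σ

/-- The clauses of the simultaneous inductive definition of `≤` (here `L`) and `<` (here `S`). -/
def OrderClosed (L S : M.Elem → M.Elem → H) : Prop :=
  (∀ σ τ, M.nonzero σ 0 ⊔ (M.val σ 0 0 ⊓ ⨅ n, M.subMem (fun ρ => S ρ τ) σ n) ≤ L σ τ) ∧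
  (∀ σ τ, M.val τ 0 0 ⊓ (⨆ n, M.subMem (fun ρ => L σ ρ) τ n) ≤ S σ τ)

/-- `σ ≤ τ`. -/
def le (σ τ : M.Elem) : H :=
  ⨅ L : M.Elem → M.Elem → H, ⨅ S : M.Elem → M.Elem → H, ⨅ _ : M.OrderClosed L S, L σ τ

/-- `σ < τ`. -/
def lt (σ τ : M.Elem) : H :=
  ⨅ L : M.Elem → M.Elem → H, ⨅ S : M.Elem → M.Elem → H, ⨅ _ : M.OrderClosed L S, S σ τ

/-! ### Special Cantor-Bendixson sets -/

/-- The elements of `CB*_σ` that are obtained by at most `k` uses of the recursive clause. -/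
def CBStage : ℕ → M.Elem → M.Elem → H
  | 0, _, α => M.isZero α
  | k + 1, σ, α => M.isZero α ⊔
      (M.val σ 0 0 ⊓ ⨆ n, M.subMem (fun ρ => ⨆ β, M.isShift n β α ⊓ CBStage k ρ β) σ n)

/-- The special Cantor-Bendixson set `CB*_σ`: it is `{0}` if `σ` is empty, and
`{0} ∪ ⋃ n, 0^n ∗ ⟨1⟩ ∗ CB*_(σ^n)` if `σ` is non-empty; see `CB_eq`. -/
def CB (σ α : M.Elem) : H := ⨆ k, M.CBStage k σ α

/-- The closure of `X`: every initial part of `α` is an initial part of an element of `X`. -/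
def cl (X : M.Elem → H) (α : M.Elem) : H := ⨅ n, ⨆ β, X β ⊓ M.agree n α β

/-- `Share(X)`: the set of all `β` that admit an element of `X`. -/
def Share (X : M.Elem → H) (β : M.Elem) : H := ⨆ α, X α ⊓ M.admits β α

/-! ### Reducibility and productivity -/

/-- `γ` codes a continuous function from Baire space to itself: for all `n` and `α`, the
sequence `γ^n` is non-zero at (the code of) some initial part of `α`. -/
def isFun (γ : M.Elem) : H :=
  ⨅ n, ⨅ α, ⨆ l : List ℕ, M.passes α l ⊓ M.nonzero γ (pairJ n (seqCode l))

/-- `(γ|α)(n) = p`: at some initial part of `α` the value of `γ^n` is `p + 1`, and it is `0` at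
all shorter ones. -/
def isValue (γ α : M.Elem) (n p : ℕ) : H :=
  ⨆ l : List ℕ, M.passes α l ⊓ M.val γ (pairJ n (seqCode l)) (p + 1) ⊓
    ⨅ i : Fin l.length, M.val γ (pairJ n (seqCode (l.take i))) 0

/-- `γ|α = β`. -/
def isImage (γ α β : M.Elem) : H := ⨅ n, ⨆ p, M.isValue γ α n p ⊓ M.val β n p

/-- `γ|α` belongs to `Y`. -/
def imageMem (Y : M.Elem → H) (γ α : M.Elem) : H := ⨆ β, M.isImage γ α β ⊓ Y β

/-- `X` reduces to `Y`: there is a continuous function `γ` such that, for each `α`, `α` belongs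
to `X` if and only if `γ|α` belongs to `Y`. -/
def reduces (X Y : M.Elem → H) : H :=
  ⨆ γ, M.isFun γ ⊓ ⨅ α, (X α ⇨ M.imageMem Y γ α) ⊓ (M.imageMem Y γ α ⇨ X α)

/-- `D^n(X)`: the set of all `α` such that, for some `i < n`, `α^i` belongs to `X`. -/
def disj (n : ℕ) (X : M.Elem → H) (α : M.Elem) : H := ⨆ i : Fin n, M.subMem X α i

/-- `C^n(X)`: the set of all `α` such that, for all `i < n`, `α^i` belongs to `X`. -/
def conj (n : ℕ) (X : M.Elem → H) (α : M.Elem) : H := ⨅ i : Fin n, M.subMem X α i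

/-- `X` is disjunctively productive: for each `n`, `D^(n+1)(X)` does not reduce to `D^n(X)`. -/
def disjProductive (X : M.Elem → H) : H := ⨅ n, (M.reduces (M.disj (n + 1) X) (M.disj n X))ᶜ

/-- `X` is conjunctively productive: for each `n`, `C^(n+1)(X)` does not reduce to `C^n(X)`. -/
def conjProductive (X : M.Elem → H) : H := ⨅ n, (M.reduces (M.conj (n + 1) X) (M.conj n X))ᶜ

/-! ### The defining equations of stumps, of their order and of the sets `CB*_σ` -/

theorem subMem_mono {X Y : M.Elem → H} (h : ∀ α, X α ≤ Y α) (α : M.Elem) (n : ℕ) :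
    M.subMem X α n ≤ M.subMem Y α n :=
  iSup_mono fun ρ => inf_le_inf_left _ (h ρ)

theorem Stp_le {Q : M.Elem → H} (hQ : M.StumpClosed Q) (σ : M.Elem) : M.Stp σ ≤ Q σ :=
  iInf₂_le Q hQ

theorem Stp_closed : M.StumpClosed M.Stp := by
  refine ⟨fun β => le_iInf₂ fun Q hQ => hQ.1 β, fun β => le_iInf₂ fun Q hQ => ?_⟩
  refine le_trans (inf_le_inf_left _ (iInf_mono fun n => ?_)) (hQ.2 β)
  exact M.subMem_mono (fun ρ => M.Stp_le hQ ρ) β n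

theorem le_le {L S : M.Elem → M.Elem → H} (h : M.OrderClosed L S) (σ τ : M.Elem) :
    M.le σ τ ≤ L σ τ :=
  iInf_le_of_le L (iInf_le_of_le S (iInf_le _ h))

theorem lt_le {L S : M.Elem → M.Elem → H} (h : M.OrderClosed L S) (σ τ : M.Elem) :
    M.lt σ τ ≤ S σ τ :=
  iInf_le_of_le L (iInf_le_of_le S (iInf_le _ h))

theorem order_closed : M.OrderClosed M.le M.lt := by
  refine ⟨fun σ τ => le_iInf₂ fun L S => le_iInf fun h => ?_,
    fun σ τ => le_iInf₂ fun L S => le_iInf fun h => ?_⟩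
  · refine le_trans (sup_le_sup_left (inf_le_inf_left _ (iInf_mono fun n => ?_)) _) (h.1 σ τ)
    exact M.subMem_mono (fun ρ => M.lt_le h ρ τ) σ n
  · refine le_trans (inf_le_inf_left _ (iSup_mono fun n => ?_)) (h.2 σ τ)
    exact M.subMem_mono (fun ρ => M.le_le h σ ρ) τ n

theorem order_closed_step : M.OrderClosed
    (fun σ τ => M.nonzero σ 0 ⊔ (M.val σ 0 0 ⊓ ⨅ n, M.subMem (fun ρ => M.lt ρ τ) σ n))
    (fun σ τ => M.val τ 0 0 ⊓ (⨆ n, M.subMem (fun ρ => M.le σ ρ) τ n)) := by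
  refine ⟨fun σ τ => ?_, fun σ τ => ?_⟩
  · refine sup_le_sup_left (inf_le_inf_left _ (iInf_mono fun n => ?_)) _
    exact M.subMem_mono (fun ρ => M.order_closed.2 ρ τ) σ n
  · refine inf_le_inf_left _ (iSup_mono fun n => ?_)
    exact M.subMem_mono (fun ρ => M.order_closed.1 σ ρ) τ n

/-- `σ ≤ τ` if and only if `σ` is empty, or `σ` is non-empty and, for all `n`, `σ^n < τ`. -/
theorem le_eq (σ τ : M.Elem) : M.le σ τ =
    M.nonzero σ 0 ⊔ (M.val σ 0 0 ⊓ ⨅ n, M.subMem (fun ρ => M.lt ρ τ) σ n) :=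
  le_antisymm (M.le_le M.order_closed_step σ τ) (M.order_closed.1 σ τ)

/-- `σ < τ` if and only if `τ` is non-empty and, for some `n`, `σ ≤ τ^n`. -/
theorem lt_eq (σ τ : M.Elem) : M.lt σ τ =
    M.val τ 0 0 ⊓ (⨆ n, M.subMem (fun ρ => M.le σ ρ) τ n) :=
  le_antisymm (M.lt_le M.order_closed_step σ τ) (M.order_closed.2 σ τ)

/-- `CB*_σ = {0}` if `σ` is empty, `CB*_σ = {0} ∪ ⋃ n, 0^n ∗ ⟨1⟩ ∗ CB*_(σ^n)` otherwise. -/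
theorem CB_eq (σ α : M.Elem) : M.CB σ α = M.isZero α ⊔
    (M.val σ 0 0 ⊓ ⨆ n, M.subMem (fun ρ => ⨆ β, M.isShift n β α ⊓ M.CB ρ β) σ n) := by
  apply le_antisymm
  · refine iSup_le fun k => ?_
    cases k with
    | zero => exact le_sup_left
    | succ k =>
      refine sup_le_sup_left (inf_le_inf_left _ (iSup_mono fun n => ?_)) _
      refine M.subMem_mono (fun ρ => iSup_mono fun β => inf_le_inf_left _ ?_) σ n
      exact le_iSup (fun k => M.CBStage k ρ β) k
  · refine sup_le (le_iSup (fun k => M.CBStage k σ α) 0) ?_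
    simp only [CB, subMem, inf_iSup_eq]
    refine iSup_le fun n => iSup_le fun ρ => iSup_le fun β => iSup_le fun k => ?_
    refine le_trans ?_ (le_iSup (fun k => M.CBStage k σ α) (k + 1))
    refine le_trans ?_ le_sup_right
    refine inf_le_inf_left _ ?_
    refine le_trans ?_ (le_iSup _ n)
    refine le_trans ?_ (le_iSup _ ρ)
    refine inf_le_inf_left _ ?_
    exact le_iSup (fun β => M.isShift n β α ⊓ M.CBStage k ρ β) β

end BaireInterp

namespace BaireInterp

variable {H : Type u} [Order.Frame H] (M : BaireInterp.{u, v} H)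

/-! ### Reasoning with truth values -/

/-- The forcing step: a nonzero condition below an existential statement can be strengthened to a
nonzero condition that settles a witness. -/
theorem exists_inf_ne_bot {ι : Sort*} {q : H} (hq : q ≠ ⊥) {a : ι → H} (h : q ≤ ⨆ i, a i) :
    ∃ i, q ⊓ a i ≠ ⊥ := by
  by_contra! hc
  apply hq
  rw [← inf_eq_left.2 h, inf_iSup_eq]
  exact iSup_eq_bot.2 hc

theorem le_of_le_iSup {ι : Sort*} {q c : H} {a : ι → H} (h : q ≤ ⨆ i, a i)
    (hi : ∀ i, q ⊓ a i ≤ c) : q ≤ c := by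
  rw [← inf_eq_left.2 h, inf_iSup_eq]
  exact iSup_le hi

theorem ne_bot_of_le {q q' : H} (h : q' ≤ q) (hq : q' ≠ ⊥) : q ≠ ⊥ :=
  fun hb => hq (le_bot_iff.1 (hb ▸ h))

theorem isComplemented_iSup {ι : Type*} (s : Finset ι) (a : ι → H)
    (h : ∀ i ∈ s, IsComplemented (a i)) : IsComplemented (⨆ i ∈ s, a i) := by
  classical
  induction s using Finset.induction_on with
  | empty => simpa using isComplemented_bot
  | insert i s _ ih =>
    rw [Finset.iSup_insert]
    exact (h i (by simp)).sup (ih fun j hj => h j (by simp [hj]))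

theorem isComplemented_iInf {ι : Type*} (s : Finset ι) (a : ι → H)
    (h : ∀ i ∈ s, IsComplemented (a i)) : IsComplemented (⨅ i ∈ s, a i) := by
  classical
  induction s using Finset.induction_on with
  | empty => simpa using isComplemented_top
  | insert i s _ ih =>
    rw [Finset.iInf_insert]
    exact (h i (by simp)).inf (ih fun j hj => h j (by simp [hj]))

theorem sup_compl_eq_top {a : H} (h : IsComplemented a) : a ⊔ aᶜ = ⊤ := by
  obtain ⟨b, hb⟩ := h
  rw [hb.compl_eq]
  exact hb.sup_eq_top

/-- A nonzero truth value can be shrunk so as to decide finitely many decidable propositions. -/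
theorem exists_decides {ι : Type*} (s : Finset ι) (a : ι → H) (h : ∀ i ∈ s, IsComplemented (a i))
    {q : H} (hq : q ≠ ⊥) : ∃ q' ≤ q, q' ≠ ⊥ ∧ ∀ i ∈ s, q' ≤ a i ∨ q' ⊓ a i = ⊥ := by
  classical
  induction s using Finset.induction_on with
  | empty => exact ⟨q, le_rfl, hq, by simp⟩
  | insert i s _ ih =>
    obtain ⟨q1, h1, hq1, hs⟩ := ih fun j hj => h j (by simp [hj])
    by_cases hb : q1 ⊓ a i = ⊥
    · exact ⟨q1, h1, hq1, fun j hj => (Finset.mem_insert.1 hj).elim (fun e => .inr (e ▸ hb)) (hs j)⟩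
    · refine ⟨q1 ⊓ a i, inf_le_left.trans h1, hb, fun j hj => ?_⟩
      rcases Finset.mem_insert.1 hj with rfl | hj
      · exact .inl inf_le_right
      · refine (hs j hj).imp inf_le_left.trans fun e => ?_
        exact le_bot_iff.1 (e ▸ inf_le_inf_right _ inf_le_left)

variable {M}

theorem eq_of_le_val {q : H} (hq : q ≠ ⊥) {α : M.Elem} {n m m' : ℕ} (h : q ≤ M.val α n m)
    (h' : q ≤ M.val α n m') : m = m' := by
  by_contra hne
  exact hq (le_bot_iff.1 (M.val_unique α n m m' hne ▸ le_inf h h'))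

/-- The join of the truth values of all other values is a complement. All decidability used below
rests on this. -/
theorem isComplemented_val (α : M.Elem) (n m : ℕ) : IsComplemented (M.val α n m) := by
  refine ⟨⨆ m', ⨆ _ : m ≠ m', M.val α n m', ?_, ?_⟩
  · rw [disjoint_iff, inf_iSup_eq]
    simp only [inf_iSup_eq, iSup_eq_bot]
    exact fun m' hm => M.val_unique α n m m' hm
  · rw [codisjoint_iff_le_sup, ← M.val_total α n]
    refine iSup_le fun m' => ?_
    by_cases h : m = m'
    · exact h ▸ le_sup_left
    · exact (le_iSup₂ (f := fun m' (_ : m ≠ m') => M.val α n m') m' h).trans le_sup_right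

/-! ### Initial parts -/

theorem le_passes_iff {q : H} {α : M.Elem} {l : List ℕ} :
    q ≤ M.passes α l ↔ ∀ i < l.length, q ≤ M.val α i (l.getD i 0) := by
  simp only [passes, le_iInf_iff]
  constructor
  · intro h i hi
    rw [List.getD_eq_getElem _ _ hi]
    exact h ⟨i, hi⟩
  · intro h i
    have := h i i.2
    rwa [List.getD_eq_getElem _ _ i.2] at this

theorem passes_le_val {α : M.Elem} {l : List ℕ} {i : ℕ} (hi : i < l.length) :
    M.passes α l ≤ M.val α i (l.getD i 0) :=
  le_passes_iff.1 le_rfl i hi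

theorem passes_anti {α : M.Elem} {l l' : List ℕ} (h : l <+: l') :
    M.passes α l' ≤ M.passes α l := by
  obtain ⟨t, rfl⟩ := h
  refine le_passes_iff.2 fun i hi => ?_
  have := passes_le_val (M := M) (α := α) (l := l ++ t) (i := i) (by simp; omega)
  rwa [List.getD_append _ _ _ _ hi] at this

theorem passes_nil (α : M.Elem) : M.passes α [] = ⊤ :=
  top_le_iff.1 (le_passes_iff.2 (by simp))

theorem passes_append_singleton (α : M.Elem) (l : List ℕ) (m : ℕ) :
    M.passes α (l ++ [m]) = M.passes α l ⊓ M.val α l.length m := by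
  apply le_antisymm
  · refine le_inf (passes_anti (List.prefix_append _ _)) ?_
    have := passes_le_val (M := M) (α := α) (l := l ++ [m]) (i := l.length) (by simp)
    simpa using this
  · refine le_passes_iff.2 fun i hi => ?_
    simp only [List.length_append, List.length_singleton] at hi
    rcases Nat.lt_succ_iff_lt_or_eq.1 hi with h | rfl
    · rw [List.getD_append _ _ _ _ h]
      exact inf_le_left.trans (passes_le_val h)
    · simp

theorem iSup_passes (α : M.Elem) (n : ℕ) :
    ⨆ l : List ℕ, ⨆ _ : l.length = n, M.passes α l = ⊤ := by
  induction n with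
  | zero =>
    refine top_le_iff.1 (le_trans ?_ (le_iSup₂ (f := fun l (_ : l.length = 0) => M.passes α l) [] rfl))
    rw [passes_nil]
  | succ n ih =>
    rw [← top_le_iff, ← ih]
    refine iSup₂_le fun l hl => ?_
    rw [← inf_top_eq (M.passes α l), ← M.val_total α n, inf_iSup_eq]
    refine iSup_le fun m => ?_
    subst hl
    rw [← passes_append_singleton]
    exact le_iSup₂ (f := fun l (_ : l.length = _) => M.passes α l) (l ++ [m]) (by simp)

theorem le_of_forall_passes {q c : H} (α : M.Elem) (n : ℕ)
    (h : ∀ l : List ℕ, l.length = n → q ⊓ M.passes α l ≤ c) : q ≤ c := by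
  refine le_of_le_iSup (q := q) (le_top.trans (iSup_passes α n).ge) fun l => ?_
  rw [inf_iSup_eq]
  exact iSup_le fun hl => h l hl

theorem exists_inf_passes_ne_bot {q : H} (hq : q ≠ ⊥) (α : M.Elem) (n : ℕ) :
    ∃ l : List ℕ, l.length = n ∧ q ⊓ M.passes α l ≠ ⊥ := by
  by_contra! hc
  exact hq (le_bot_iff.1 (le_of_forall_passes α n fun l hl => (hc l hl).le))

theorem prefix_of_le_passes {q : H} (hq : q ≠ ⊥) {α : M.Elem} {l l' : List ℕ}
    (h : q ≤ M.passes α l) (h' : q ≤ M.passes α l') (hl : l.length ≤ l'.length) : l <+: l' := by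
  rw [List.prefix_iff_eq_take]
  apply List.ext_getElem (by simp [hl])
  intro i h1 h2
  have a := le_passes_iff.1 h i h1
  have b := le_passes_iff.1 h' i (by omega)
  have := eq_of_le_val hq a b
  rw [List.getD_eq_getElem _ _ h1, List.getD_eq_getElem _ _ (by omega)] at this
  simpa using this

/-- The initial part of length `n` of a sequence. -/
def initial (f : ℕ → ℕ) (n : ℕ) : List ℕ := (List.range n).map f

@[simp] theorem length_initial (f : ℕ → ℕ) (n : ℕ) : (initial f n).length = n := by simp [initial]

theorem getD_initial (f : ℕ → ℕ) {n i : ℕ} (h : i < n) : (initial f n).getD i 0 = f i := by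
  rw [List.getD_eq_getElem _ _ (by simpa using h)]
  simp [initial]

theorem initial_eq_iff {f g : ℕ → ℕ} {n : ℕ} :
    initial f n = initial g n ↔ ∀ i < n, f i = g i := by
  simp [initial, List.map_inj_left]

theorem initial_prefix (f : ℕ → ℕ) {m n : ℕ} (h : m ≤ n) : initial f m <+: initial f n := by
  rw [List.prefix_iff_eq_take, initial, initial, ← List.map_take, List.take_range]
  simp [h]

theorem initial_getD (l : List ℕ) : initial (fun i => l.getD i 0) l.length = l := by
  apply List.ext_getElem (by simp)
  intro i h1 h2
  simp only [initial, List.getElem_map, List.getElem_range]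
  exact List.getD_eq_getElem _ _ h2

/-- `α` is the sequence `f`. -/
def isStd (α : M.Elem) (f : ℕ → ℕ) : H := ⨅ n, M.val α n (f n)

theorem isStd_le_val (α : M.Elem) (f : ℕ → ℕ) (n : ℕ) : isStd α f ≤ M.val α n (f n) := iInf_le _ n

theorem isStd_le_passes (α : M.Elem) (f : ℕ → ℕ) (n : ℕ) :
    isStd α f ≤ M.passes α (initial f n) := by
  refine le_passes_iff.2 fun i hi => ?_
  rw [getD_initial f (by simpa using hi)]
  exact isStd_le_val α f i

theorem eq_initial_of_passes {q : H} (hq : q ≠ ⊥) {α : M.Elem} {f : ℕ → ℕ} {l : List ℕ}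
    (h : q ≤ isStd α f) (hl : q ≤ M.passes α l) : l = initial f l.length :=
  (prefix_of_le_passes hq hl (h.trans (isStd_le_passes α f l.length)) (by simp)).eq_of_length
    (by simp)

theorem agree_inf_passes {α β : M.Elem} {l : List ℕ} {n : ℕ} (hl : l.length ≤ n) :
    M.agree n α β ⊓ M.passes α l ≤ M.passes β l := by
  refine le_passes_iff.2 fun i hi => ?_
  refine le_of_le_iSup (a := fun p => M.val α i p ⊓ M.val β i p)
    (inf_le_left.trans (iInf_le _ (⟨i, hi.trans_le hl⟩ : Fin n))) fun p => ?_
  by_cases hp : p = l.getD i 0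
  · exact hp ▸ inf_le_right.trans inf_le_right
  · have : M.val α i p ⊓ M.val α i (l.getD i 0) = ⊥ := M.val_unique α i _ _ hp
    refine le_trans ?_ bot_le
    rw [← this]
    exact le_inf (inf_le_right.trans inf_le_left)
      (inf_le_left.trans (inf_le_right.trans (passes_le_val hi)))

theorem passes_inf_passes_le_agree {α β : M.Elem} {l : List ℕ} :
    M.passes α l ⊓ M.passes β l ≤ M.agree l.length α β := by
  refine le_iInf fun i => le_iSup_of_le (l.getD i 0) ?_
  exact inf_le_inf (passes_le_val i.2) (passes_le_val i.2)

/-! ### Definable relations -/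

variable (M) in
theorem Definable.top (k : ℕ) : M.Definable k (fun _ => ⊤) := by
  simpa using Definable.imp (Definable.bot (M := M) (k := k)) Definable.bot

theorem Definable.exCountable {k : ℕ} {ι : Type*} [Countable ι] {φ : ι → (Fin k → M.Elem) → H}
    (h : ∀ i, M.Definable k (φ i)) : M.Definable k (fun x => ⨆ i, φ i x) := by
  rcases isEmpty_or_nonempty ι with hι | hι
  · simp only [iSup_of_empty]
    exact Definable.bot
  · obtain ⟨e, he⟩ := exists_surjective_nat ι
    have : (fun x => ⨆ i, φ i x) = fun x => ⨆ n, φ (e n) x := by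
      funext x
      exact (he.iSup_comp (g := fun i => φ i x)).symm
    rw [this]
    exact Definable.exNat fun n => h (e n)

theorem Definable.allCountable {k : ℕ} {ι : Type*} [Countable ι] {φ : ι → (Fin k → M.Elem) → H}
    (h : ∀ i, M.Definable k (φ i)) : M.Definable k (fun x => ⨅ i, φ i x) := by
  rcases isEmpty_or_nonempty ι with hι | hι
  · simp only [iInf_of_empty]
    exact Definable.top M k
  · obtain ⟨e, he⟩ := exists_surjective_nat ι
    have : (fun x => ⨅ i, φ i x) = fun x => ⨅ n, φ (e n) x := by
      funext x
      exact (he.iInf_comp (g := fun i => φ i x)).symm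
    rw [this]
    exact Definable.allNat fun n => h (e n)

theorem Definable.exProp {k : ℕ} {P : Prop} {φ : (Fin k → M.Elem) → H}
    (h : M.Definable k φ) : M.Definable k (fun x => ⨆ _ : P, φ x) := by
  by_cases hP : P
  · simpa [hP] using h
  · simpa [hP] using Definable.bot

theorem Definable.passes {k : ℕ} (i : Fin k) (l : List ℕ) :
    M.Definable k (fun x => M.passes (x i) l) :=
  Definable.allCountable fun _ => Definable.val _ _ _

theorem Definable.isValue {k : ℕ} (i j : Fin k) (n p : ℕ) :
    M.Definable k (fun x => M.isValue (x i) (x j) n p) :=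
  Definable.exCountable fun _ => Definable.and
    (Definable.and (Definable.passes _ _) (Definable.val _ _ _))
    (Definable.allCountable fun _ => Definable.val _ _ _)

/-! ### Existence of sequences -/

section

variable (hM : M.AC00)
include hM

/-- Choice is applied to the graph of `f`, whose truth values are just `⊤` and `⊥`. This makes every
external sequence available in the interpretation. -/
theorem iSup_isStd (f : ℕ → ℕ) : ⨆ α : M.Elem, isStd α f = ⊤ := by
  have := hM 0 (fun m n _ => ⨆ _ : n = f m, ⊤) (fun m n => Definable.exProp (Definable.top M _))
    Fin.elim0
  rw [← top_le_iff]
  refine le_trans (le_iInf fun m => le_iSup_of_le (f m) ?_)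
    (this.trans (iSup_mono fun α => iInf_mono fun m => iSup_le fun n => ?_))
  · simp
  · rw [inf_iSup_eq]
    exact iSup_le fun h => h ▸ inf_le_left

theorem iSup_isSub (α : M.Elem) (n : ℕ) : ⨆ ρ, M.isSub α n ρ = ⊤ := by
  have := hM 1 (fun j p x => M.val (x 0) (pairJ n j) p) (fun m n => Definable.val _ _ _) ![α]
  rw [← top_le_iff]
  refine le_trans (le_iInf fun m => ?_)
    (this.trans (iSup_mono fun α => iInf_mono fun m => iSup_mono fun p => ?_))
  · simp [M.val_total]
  · simp [inf_comm]

theorem isFun_le_iSup_isImage {γ α : M.Elem} {q : H}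
    (h : ∀ n, q ≤ ⨆ p, M.isValue γ α n p) : q ≤ ⨆ β, M.isImage γ α β := by
  have := hM 2 (fun j p x => M.isValue (x 0) (x 1) j p) (fun m n => Definable.isValue _ _ _ _)
    ![γ, α]
  refine le_trans (le_iInf fun m => ?_)
    (this.trans (iSup_mono fun α => iInf_mono fun m => iSup_mono fun p => ?_))
  · simpa using h m
  · simp [inf_comm]

/-- `β(n)` is the value of `F` at the initial part of length `n` of `ζ`. -/
def isTrans (F : List ℕ → ℕ) (ζ β : M.Elem) : H :=
  ⨅ w : List ℕ, M.passes ζ w ⇨ M.val β w.length (F w)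

theorem iSup_isTrans (F : List ℕ → ℕ) (ζ : M.Elem) : ⨆ β, isTrans F ζ β = ⊤ := by
  have := hM 1 (fun n m x => ⨆ w : List ℕ, ⨆ _ : w.length = n ∧ F w = m, M.passes (x 0) w)
    (fun m n => Definable.exCountable fun w => Definable.exProp (Definable.passes _ _)) ![ζ]
  rw [← top_le_iff]
  refine le_trans (le_iInf fun m => ?_)
    (this.trans (iSup_mono fun β => le_iInf fun w => ?_))
  · rw [← iSup_passes ζ m]
    refine iSup₂_le fun w hw => le_iSup_of_le (F w) (le_iSup_of_le w (le_iSup_of_le ⟨hw, rfl⟩ ?_))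
    simp
  · rw [le_himp_iff]
    refine (inf_le_inf_right _ (iInf_le _ w.length)).trans ?_
    simp only [iSup_inf_eq, inf_iSup_eq]
    refine iSup_le fun m => iSup_le fun w' => iSup_le fun h => ?_
    by_cases hb : M.val β w.length m ⊓ M.passes ζ w' ⊓ M.passes ζ w = ⊥
    · simp only [Matrix.cons_val_zero]
      rw [hb]; exact bot_le
    · have : w' = w := (prefix_of_le_passes hb (inf_le_left.trans inf_le_right) inf_le_right
        h.1.le).eq_of_length h.1
      rw [← h.2, this]
      exact inf_le_left.trans inf_le_left

end

theorem isTrans_inf_passes_le {F : List ℕ → ℕ} {ζ β : M.Elem} {w : List ℕ} :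
    isTrans F ζ β ⊓ M.passes ζ w ≤ M.val β w.length (F w) :=
  le_himp_iff.1 (iInf_le _ w)

/-! ### Accessibility with truth values -/

/-- The truth value of: `x` is accessible for the relation `R`, where `R x y` is read as
"`y` is below `x`". -/
def HAcc {S : Type*} (R : S → S → H) (x : S) : H :=
  ⨅ Q : S → H, ⨅ _ : ∀ x, ⨅ y, (R x y ⇨ Q y) ≤ Q x, Q x

section HAcc

variable {S : Type*} {R : S → S → H}

theorem HAcc_le {Q : S → H} (hQ : ∀ x, ⨅ y, (R x y ⇨ Q y) ≤ Q x) (x : S) : HAcc R x ≤ Q x :=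
  iInf₂_le Q hQ

theorem HAcc_closed (x : S) : ⨅ y, (R x y ⇨ HAcc R y) ≤ HAcc R x :=
  le_iInf₂ fun _ hQ => (iInf_mono fun y => himp_le_himp_left (HAcc_le hQ y)).trans (hQ x)

theorem HAcc_le_himp (x y : S) : HAcc R x ≤ R x y ⇨ HAcc R y := by
  refine (HAcc_le (Q := fun x => ⨅ y, R x y ⇨ HAcc R y) (fun x => ?_) x).trans (iInf_le _ y)
  exact iInf_mono fun y => himp_le_himp_left (HAcc_closed y)

theorem HAcc_inf_le (x y : S) : HAcc R x ⊓ R x y ≤ HAcc R y := le_himp_iff.1 (HAcc_le_himp x y)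

/-- There is no infinite descent from an accessible point. -/
theorem HAcc_descent {bad : H → S → Prop} (h0 : ∀ q x, bad q x → q ≠ ⊥)
    (hmono : ∀ q q' x, bad q x → q' ≤ q → q' ≠ ⊥ → bad q' x)
    (hstep : ∀ q x, bad q x → ∃ q' ≤ q, ∃ y, bad q' y ∧ q' ≤ R x y)
    {q : H} {x : S} (hx : bad q x) (hq : q ≤ HAcc R x) : False := by
  -- The join of the bad conditions at `x` is the truth value of badness. Its negation passes from
  -- the points below `x` to `x`, hence holds at accessible points.
  have key : ∀ x, HAcc R x ≤ (⨆ q, ⨆ _ : bad q x, q)ᶜ := by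
    refine HAcc_le fun x => ?_
    rw [le_compl_iff_disjoint_right, disjoint_iff]
    simp only [inf_iSup_eq, iSup_eq_bot]
    intro q hb
    by_contra hne
    obtain ⟨q', hq', y, hy, hR⟩ := hstep _ _ (hmono _ _ _ hb inf_le_right hne)
    apply h0 _ _ hy
    have h1 : q' ≤ (⨆ q, ⨆ _ : bad q y, q)ᶜ :=
      (le_inf (hq'.trans (inf_le_left.trans (iInf_le _ y))) hR).trans himp_inf_le
    have h2 : q' ≤ ⨆ q, ⨆ _ : bad q y, q := le_iSup₂ (f := fun q (_ : bad q y) => q) q' hy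
    have := le_inf h2 h1
    rwa [inf_compl_self, le_bot_iff] at this
  have h1 := hq.trans (key x)
  have h2 : q ≤ ⨆ q, ⨆ _ : bad q x, q := le_iSup₂ (f := fun q (_ : bad q x) => q) q hx
  have := le_inf h2 h1
  rw [inf_compl_self, le_bot_iff] at this
  exact h0 _ _ hx this

/-- `N'` results from `N` by replacing one element by finitely many elements below it. -/
def multStep (R : S → S → H) (N N' : Multiset S) : H :=
  ⨆ (a : S) (X : Multiset S) (Y : Multiset S) (_ : N = a ::ₘ X ∧ N' = Y + X), ⨅ y ∈ Y, R a y

theorem le_multStep {q : H} (a : S) (X Y : Multiset S)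
    (h : ∀ y ∈ Y, q ≤ R a y) : q ≤ multStep R (a ::ₘ X) (Y + X) :=
  le_iSup_of_le a (le_iSup_of_le X (le_iSup_of_le Y (le_iSup_of_le ⟨rfl, rfl⟩
    (le_iInf₂ (f := fun y (_ : y ∈ Y) => R a y) h))))

/-- Double induction, on `a` outside and on `X` inside. A step from `a ::ₘ X` either replaces `a`,
and the new elements are added one by one by the outer hypothesis, or takes place in `X`, where the
inner hypothesis applies. -/
theorem HAcc_multStep_cons (a : S) :
    HAcc R a ≤ ⨅ X, (HAcc (multStep R) X ⇨ HAcc (multStep R) (a ::ₘ X)) := by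
  refine HAcc_le (Q := fun a => ⨅ X, (HAcc (multStep R) X ⇨ HAcc (multStep R) (a ::ₘ X)))
    (fun a => ?_) a
  set q := ⨅ y, (R a y ⇨ ⨅ X, (HAcc (multStep R) X ⇨ HAcc (multStep R) (y ::ₘ X))) with hq
  have hY : ∀ (Y X : Multiset S), q ⊓ (⨅ y ∈ Y, R a y) ⊓ HAcc (multStep R) X ≤
      HAcc (multStep R) (Y + X) := by
    intro Y X
    induction Y using Multiset.induction_on with
    | empty => simp
    | cons y Y ih =>
      have h1 : q ⊓ (⨅ z ∈ y ::ₘ Y, R a z) ⊓ HAcc (multStep R) X ≤ HAcc (multStep R) (Y + X) := by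
        refine le_trans (inf_le_inf_right _ (inf_le_inf_left _ ?_)) ih
        exact le_iInf₂ fun z hz => iInf₂_le z (Multiset.mem_cons_of_mem hz)
      have h2 : q ⊓ (⨅ z ∈ y ::ₘ Y, R a z) ⊓ HAcc (multStep R) X ≤
          HAcc (multStep R) (Y + X) ⇨ HAcc (multStep R) (y ::ₘ (Y + X)) := by
        have h3 := (inf_le_inf (iInf_le _ y : q ≤ _)
          (iInf₂_le (f := fun z (_ : z ∈ y ::ₘ Y) => R a z) y (Multiset.mem_cons_self y Y))).trans
          himp_inf_le
        exact inf_le_left.trans (h3.trans (iInf_le _ (Y + X)))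
      rw [Multiset.cons_add]
      exact (le_inf h2 h1).trans himp_inf_le
  -- Accessibility of `X` itself is carried along, because the case in which `a` is replaced needs
  -- it.
  have key : ∀ X, HAcc (multStep R) X ≤
      HAcc (multStep R) X ⊓ (q ⇨ HAcc (multStep R) (a ::ₘ X)) := by
    refine HAcc_le (Q := fun X => HAcc (multStep R) X ⊓ (q ⇨ HAcc (multStep R) (a ::ₘ X)))
      fun X => ?_
    set r := ⨅ Z, (multStep R X Z ⇨ HAcc (multStep R) Z ⊓ (q ⇨ HAcc (multStep R) (a ::ₘ Z)))
      with hr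
    have hrX : r ≤ HAcc (multStep R) X :=
      (iInf_mono fun Z => himp_le_himp_left inf_le_left).trans (HAcc_closed X)
    refine le_inf hrX (le_himp_iff.2 (le_trans (le_iInf fun Z => ?_) (HAcc_closed (a ::ₘ X))))
    rw [le_himp_iff]
    simp only [multStep, inf_iSup_eq]
    refine iSup_le fun b => iSup_le fun W => iSup_le fun Y => iSup_le fun ⟨h1, h2⟩ => ?_
    rcases Multiset.cons_eq_cons.1 h1 with ⟨rfl, rfl⟩ | ⟨_, W', rfl, rfl⟩
    · rw [h2]
      refine le_trans (le_inf (le_inf ?_ inf_le_right) ?_) (hY Y X)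
      · exact inf_le_left.trans inf_le_right
      · exact inf_le_left.trans (inf_le_left.trans hrX)
    · rw [h2, Multiset.add_cons]
      have h3 : r ⊓ q ⊓ (⨅ y ∈ Y, R b y) ≤ q ⇨ HAcc (multStep R) (a ::ₘ (Y + W')) := by
        refine le_trans (le_inf (inf_le_left.trans (inf_le_left.trans (iInf_le _ (Y + W')))) ?_)
          (himp_inf_le.trans inf_le_right)
        exact inf_le_right.trans (le_multStep b W' Y fun y hy => iInf₂_le y hy)
      exact (le_inf h3 (inf_le_left.trans inf_le_right)).trans himp_inf_le
  refine le_iInf fun X => le_himp_iff.2 ?_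
  exact (inf_le_inf_left q ((key X).trans inf_le_right)).trans inf_himp_le

theorem le_HAcc_multStep {q : H} (N : Multiset S) (h : ∀ a ∈ N, q ≤ HAcc R a) :
    q ≤ HAcc (multStep R) N := by
  induction N using Multiset.induction_on with
  | empty =>
    refine le_trans (le_iInf fun N' => le_himp_iff.2 ?_) (HAcc_closed _)
    simp only [multStep, inf_iSup_eq]
    exact iSup_le fun a => iSup_le fun X => iSup_le fun Y => iSup_le fun h =>
      absurd h.1 (Multiset.zero_ne_cons)
  | cons a N ih =>
    have h1 := ih fun b hb => h b (Multiset.mem_cons_of_mem hb)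
    have h2 := ((h a (Multiset.mem_cons_self a N)).trans (HAcc_multStep_cons a)).trans (iInf_le _ N)
    exact (le_inf h2 h1).trans himp_inf_le

end HAcc

/-! ### Trees and stumps -/

/-- The code of `u ∗ v`, where `j` is the code of `v`. -/
def catCode : List ℕ → ℕ → ℕ
  | [], j => j
  | n :: u, j => pairJ n (catCode u j)

theorem catCode_seqCode (u v : List ℕ) : catCode u (seqCode v) = seqCode (u ++ v) := by
  induction u with
  | nil => rfl
  | cons n u ih => simp only [catCode, List.cons_append, seqCode_cons, ih]

theorem catCode_append (u v : List ℕ) (j : ℕ) : catCode (u ++ v) j = catCode u (catCode v j) := by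
  induction u with
  | nil => rfl
  | cons n u ih => simp only [catCode, List.cons_append, ih]

theorem catCode_zero (u : List ℕ) : catCode u 0 = seqCode u := by
  simpa [seqCode] using catCode_seqCode u []

/-- `ρ` is the subsequence of `σ` at the node `u`. -/
def isSubAt (σ : M.Elem) (u : List ℕ) (ρ : M.Elem) : H :=
  ⨅ j, ⨆ p, M.val σ (catCode u j) p ⊓ M.val ρ j p

theorem iSup_inf_val_le {q : H} {ρ : M.Elem} {a : ℕ → H} {j p : ℕ}
    (h : q ≤ ⨆ p, a p ⊓ M.val ρ j p) : q ⊓ M.val ρ j p ≤ a p := by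
  refine le_of_le_iSup (a := fun p => a p ⊓ M.val ρ j p) (inf_le_left.trans h) fun p' => ?_
  by_cases hp : p' = p
  · exact hp ▸ inf_le_right.trans inf_le_left
  · refine le_trans ?_ bot_le
    rw [← M.val_unique ρ j p' p hp]
    exact le_inf (inf_le_right.trans inf_le_right) (inf_le_left.trans inf_le_right)

theorem isSubAt_inf_val_le {σ ρ : M.Elem} {u : List ℕ} {j p : ℕ} :
    isSubAt σ u ρ ⊓ M.val ρ j p ≤ M.val σ (catCode u j) p :=
  iSup_inf_val_le (iInf_le _ j)

theorem isSubAt_inf_val_le' {σ ρ : M.Elem} {u : List ℕ} {j p : ℕ} :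
    isSubAt σ u ρ ⊓ M.val σ (catCode u j) p ≤ M.val ρ j p :=
  iSup_inf_val_le ((iInf_le _ j).trans (iSup_mono fun _ => (inf_comm _ _).le))

theorem isSub_inf_val_le {σ ρ : M.Elem} {n j p : ℕ} :
    M.isSub σ n ρ ⊓ M.val ρ j p ≤ M.val σ (pairJ n j) p :=
  iSup_inf_val_le (iInf_le _ j)

theorem isSub_inf_val_le' {σ ρ : M.Elem} {n j p : ℕ} :
    M.isSub σ n ρ ⊓ M.val σ (pairJ n j) p ≤ M.val ρ j p :=
  iSup_inf_val_le ((iInf_le _ j).trans (iSup_mono fun _ => (inf_comm _ _).le))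

theorem isSubAt_nil (σ : M.Elem) : isSubAt σ [] σ = ⊤ := by
  simp [isSubAt, catCode, M.val_total]

theorem isSubAt_inf_isSub_le (σ ρ ρ' : M.Elem) (u : List ℕ) (n : ℕ) :
    isSubAt σ u ρ ⊓ M.isSub ρ n ρ' ≤ isSubAt σ (u ++ [n]) ρ' := by
  refine le_iInf fun j => ?_
  refine le_of_le_iSup (inf_le_right.trans (iInf_le _ j)) fun p => le_iSup_of_le p ?_
  refine le_inf ?_ (inf_le_right.trans inf_le_right)
  rw [catCode_append]
  exact (le_inf (inf_le_left.trans inf_le_left) (inf_le_right.trans inf_le_left)).trans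
    isSubAt_inf_val_le

/-- `v` is an immediate successor of the node `u`, and `σ` is not empty at `u`. -/
def treeRel (σ : M.Elem) (u v : List ℕ) : H := ⨆ (n : ℕ) (_ : v = u ++ [n]), M.val σ (seqCode u) 0

theorem treeRel_append (σ : M.Elem) (u : List ℕ) (n : ℕ) :
    treeRel σ u (u ++ [n]) = M.val σ (seqCode u) 0 :=
  le_antisymm (iSup₂_le fun _ _ => le_rfl) (le_iSup₂ (f := fun m (_ : u ++ [n] = u ++ [m]) =>
    M.val σ (seqCode u) 0) n rfl)

theorem le_HAcc_treeRel {σ : M.Elem} {q : H} {u : List ℕ}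
    (h : ∀ n, q ⊓ M.val σ (seqCode u) 0 ≤ HAcc (treeRel σ) (u ++ [n])) :
    q ≤ HAcc (treeRel σ) u := by
  refine le_trans (le_iInf fun v => le_himp_iff.2 ?_) (HAcc_closed u)
  simp only [treeRel, inf_iSup_eq]
  exact iSup₂_le fun n hn => hn ▸ h n

/-- Stump induction on the predicate "every node of `σ` at which this sequence sits is accessible".
At an empty stump the relation has no successors. -/
theorem Stp_le_HAcc (σ : M.Elem) : M.Stp σ ≤ HAcc (treeRel σ) [] := by
  have hQ : M.StumpClosed (fun ρ => ⨅ u, isSubAt σ u ρ ⇨ HAcc (treeRel σ) u) := by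
    refine ⟨fun β => le_iInf fun u => le_himp_iff.2 ?_, fun β => le_iInf fun u => le_himp_iff.2 ?_⟩
    · refine le_HAcc_treeRel fun n => le_trans ?_ bot_le
      rw [← catCode_zero]
      refine le_of_le_iSup (a := fun p => M.val β 0 (p + 1))
        (inf_le_left.trans inf_le_left) fun p => ?_
      rw [← M.val_unique β 0 (p + 1) 0 (by omega)]
      refine le_inf inf_le_right (inf_le_left.trans ?_)
      exact (inf_le_inf_right _ inf_le_right).trans isSubAt_inf_val_le'
    · refine le_HAcc_treeRel fun n => ?_
      refine le_of_le_iSup (inf_le_left.trans (inf_le_left.trans (inf_le_right.trans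
        (iInf_le _ n)))) fun ρ => ?_
      refine le_trans (le_inf ?_ ?_) (himp_inf_le (a := isSubAt σ (u ++ [n]) ρ))
      · exact inf_le_right.trans (inf_le_right.trans (iInf_le _ _))
      · refine le_trans (le_inf ?_ (inf_le_right.trans inf_le_left))
          (isSubAt_inf_isSub_le σ β ρ u n)
        exact inf_le_left.trans (inf_le_left.trans inf_le_right)
  refine (M.Stp_le hQ σ).trans ((iInf_le _ []).trans ?_)
  rw [isSubAt_nil, top_himp]

/-- The converse is an induction along the tree, in which the value of `ρ` at `0` decides the clause
that applies. -/
theorem HAcc_le_Stp (hM : M.AC00) (τ : M.Elem) : HAcc (treeRel τ) [] ≤ M.Stp τ := by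
  have : HAcc (treeRel τ) [] ≤ ⨅ ρ, isSubAt τ [] ρ ⇨ M.Stp ρ := by
    refine HAcc_le (Q := fun l => ⨅ ρ, isSubAt τ l ρ ⇨ M.Stp ρ) (fun l => ?_) []
    refine le_iInf fun ρ => le_himp_iff.2 ?_
    refine le_of_le_iSup (a := M.val ρ 0) (le_top.trans (M.val_total ρ 0).ge) fun p => ?_
    cases p with
    | succ p => exact inf_le_right.trans ((le_iSup (fun p => M.val ρ 0 (p + 1)) p).trans
        (M.Stp_closed.1 ρ))
    | zero =>
      refine le_trans (le_inf inf_le_right (le_iInf fun n => ?_)) (M.Stp_closed.2 ρ)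
      refine le_of_le_iSup (le_top.trans (iSup_isSub hM ρ n).ge) fun ρ' => ?_
      refine le_iSup_of_le ρ' (le_inf inf_le_right ?_)
      have h1 : (⨅ y, treeRel τ l y ⇨ ⨅ ρ, isSubAt τ y ρ ⇨ M.Stp ρ) ⊓ isSubAt τ l ρ ⊓
          M.val ρ 0 0 ⊓ M.isSub ρ n ρ' ≤ treeRel τ l (l ++ [n]) := by
        rw [treeRel_append, ← catCode_zero]
        exact (inf_le_left.trans (inf_le_inf_right _ inf_le_right)).trans isSubAt_inf_val_le
      have h2 : (⨅ y, treeRel τ l y ⇨ ⨅ ρ, isSubAt τ y ρ ⇨ M.Stp ρ) ⊓ isSubAt τ l ρ ⊓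
          M.val ρ 0 0 ⊓ M.isSub ρ n ρ' ≤ isSubAt τ (l ++ [n]) ρ' :=
        (inf_le_inf_right _ (inf_le_left.trans inf_le_right)).trans
          (isSubAt_inf_isSub_le τ ρ ρ' l n)
      have h3 := (le_inf (inf_le_left.trans (inf_le_left.trans (inf_le_left.trans
        (iInf_le _ (l ++ [n]))))) h1).trans himp_inf_le
      exact (le_inf (h3.trans (iInf_le _ ρ')) h2).trans himp_inf_le
  refine this.trans ((iInf_le _ τ).trans ?_)
  rw [isSubAt_nil, top_himp]

/-! ### The elements of the special Cantor-Bendixson sets -/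

/-- The sequence `0^(n₁) ∗ ⟨1⟩ ∗ … ∗ 0^(nᵣ) ∗ ⟨1⟩ ∗ 0`. -/
def pointFn : List ℕ → ℕ → ℕ
  | [], _ => 0
  | n :: l, i => if i < n then 0 else if i = n then 1 else pointFn l (i - n - 1)

/-- The source of all convergence: the points of `l ++ [c]` and of all its descendants agree with
the point of `l` up to `c`. -/
theorem pointFn_append_of_lt (l r : List ℕ) {c i : ℕ} (h : i < c) :
    pointFn (l ++ c :: r) i = pointFn l i := by
  induction l generalizing i with
  | nil => simp [pointFn, h]
  | cons n l ih =>
    simp only [List.cons_append, pointFn]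
    rw [ih (by omega)]

theorem pointFn_injective : Function.Injective pointFn := by
  intro l
  induction l with
  | nil =>
    intro l' h
    cases l' with
    | nil => rfl
    | cons n l' => simpa [pointFn] using congrFun h n
  | cons n l ih =>
    intro l' h
    cases l' with
    | nil => simpa [pointFn] using congrFun h n
    | cons m l' =>
      have hnm : n = m := by
        rcases lt_trichotomy n m with hlt | he | hlt
        · simpa [pointFn, hlt] using congrFun h n
        · exact he
        · simpa [pointFn, hlt] using congrFun h m
      subst hnm
      rw [ih]
      funext i
      have := congrFun h (n + 1 + i)
      simpa [pointFn, show ¬ n + 1 + i < n by omega, show n + 1 + i ≠ n by omega,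
        show n + 1 + i - n - 1 = i by omega] using this

/-- All proper initial parts of `l` are nodes at which `τ` is not empty. -/
def valid (τ : M.Elem) (l : List ℕ) : H := ⨅ i : Fin l.length, M.val τ (seqCode (l.take i)) 0

theorem valid_nil (τ : M.Elem) : valid τ [] = ⊤ :=
  top_le_iff.1 (le_iInf fun i => absurd i.2 (by simp))

theorem le_valid_iff {τ : M.Elem} {q : H} {l : List ℕ} :
    q ≤ valid τ l ↔ ∀ i < l.length, q ≤ M.val τ (seqCode (l.take i)) 0 := by
  rw [valid, le_iInf_iff]
  exact ⟨fun h i hi => h ⟨i, hi⟩, fun h i => h i i.2⟩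

theorem valid_anti {τ : M.Elem} {l l' : List ℕ} (h : l <+: l') : valid τ l' ≤ valid τ l := by
  obtain ⟨t, rfl⟩ := h
  refine le_valid_iff.2 fun i hi => ?_
  have := le_valid_iff.1 (le_refl (valid τ (l ++ t))) i (by simp; omega)
  rwa [List.take_append_of_le_length hi.le] at this

theorem valid_append_le {τ : M.Elem} {l r : List ℕ} {c : ℕ} :
    valid τ (l ++ c :: r) ≤ M.val τ (seqCode l) 0 := by
  have := le_valid_iff.1 (le_refl (valid τ (l ++ c :: r))) l.length (by simp)
  simpa using this

theorem le_valid_append {τ : M.Elem} {l : List ℕ} {c : ℕ} {q : H} (h : q ≤ valid τ l)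
    (h' : q ≤ M.val τ (seqCode l) 0) : q ≤ valid τ (l ++ [c]) := by
  refine le_valid_iff.2 fun i hi => ?_
  simp only [List.length_append, List.length_singleton] at hi
  rw [List.take_append_of_le_length (by omega)]
  rcases Nat.lt_succ_iff_lt_or_eq.1 hi with h1 | rfl
  · exact le_valid_iff.1 h i h1
  · simpa using h'

theorem isSub_inf_valid_le {τ ρ : M.Elem} {n : ℕ} {l : List ℕ} :
    M.isSub τ n ρ ⊓ valid τ (n :: l) ≤ valid ρ l := by
  refine le_valid_iff.2 fun i hi => ?_
  refine le_trans (inf_le_inf_left _ ?_) isSub_inf_val_le'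
  have := le_valid_iff.1 (le_refl (valid τ (n :: l))) (i + 1) (by simpa using hi)
  simpa [seqCode_cons] using this

theorem isSub_inf_valid_le' {τ ρ : M.Elem} {n : ℕ} {l : List ℕ} :
    M.val τ 0 0 ⊓ M.isSub τ n ρ ⊓ valid ρ l ≤ valid τ (n :: l) := by
  refine le_valid_iff.2 fun i hi => ?_
  cases i with
  | zero => exact inf_le_left.trans inf_le_left
  | succ i =>
    rw [List.take_succ_cons, seqCode_cons]
    refine le_trans (inf_le_inf inf_le_right ?_) isSub_inf_val_le
    exact le_valid_iff.1 le_rfl i (by simpa using hi)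

theorem isStd_le_isShift {α β : M.Elem} {n : ℕ} {l : List ℕ} :
    isStd α (pointFn (n :: l)) ⊓ isStd β (pointFn l) ≤ M.isShift n β α := by
  refine le_inf (le_inf (le_iInf fun i => ?_) ?_) (le_iInf fun j => ?_)
  · have := isStd_le_val α (pointFn (n :: l)) i
    simp only [pointFn, i.2, if_true] at this
    exact inf_le_left.trans this
  · have := isStd_le_val α (pointFn (n :: l)) n
    simp only [pointFn, lt_irrefl, if_true, if_false] at this
    exact inf_le_left.trans this
  · refine le_iSup_of_le (pointFn l j) (le_inf (inf_le_right.trans (isStd_le_val β _ j)) ?_)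
    have := isStd_le_val α (pointFn (n :: l)) (n + 1 + j)
    simp only [pointFn, show ¬ n + 1 + j < n by omega, show n + 1 + j ≠ n by omega,
      show n + 1 + j - n - 1 = j by omega, if_false] at this
    exact inf_le_left.trans this

theorem isShift_inf_isStd_le {α β : M.Elem} {n : ℕ} {l : List ℕ} :
    M.isShift n β α ⊓ isStd β (pointFn l) ≤ isStd α (pointFn (n :: l)) := by
  refine le_iInf fun i => ?_
  rcases lt_trichotomy i n with h | rfl | h
  · simp only [pointFn, h, if_true]
    exact inf_le_left.trans (inf_le_left.trans (inf_le_left.trans (iInf_le _ (⟨i, h⟩ : Fin n))))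
  · simp only [pointFn, lt_irrefl, if_true, if_false]
    exact inf_le_left.trans (inf_le_left.trans inf_le_right)
  · obtain ⟨j, rfl⟩ := Nat.exists_eq_add_of_le (Nat.succ_le_of_lt h)
    simp only [pointFn, show ¬ n.succ + j < n by omega, show n.succ + j ≠ n by omega,
      show n.succ + j - n - 1 = j by omega, if_false]
    have h1 : M.isShift n β α ≤ ⨆ p, M.val α (n + 1 + j) p ⊓ M.val β j p :=
      inf_le_right.trans ((iInf_le _ j).trans (iSup_mono fun p => (inf_comm _ _).le))
    exact (inf_le_inf_left _ (isStd_le_val β _ j)).trans (iSup_inf_val_le h1)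

/-- Together with `CBStage_le` this replaces the recursion for `CB*_τ` by a parametrization: its
elements are the points of the lists all of whose proper prefixes are non-empty nodes of `τ`. -/
theorem valid_inf_isStd_le_CB (hM : M.AC00) (l : List ℕ) (τ α : M.Elem) :
    valid τ l ⊓ isStd α (pointFn l) ≤ M.CB τ α := by
  induction l generalizing τ α with
  | nil =>
    rw [CB_eq]
    exact inf_le_right.trans (le_sup_of_le_left le_rfl)
  | cons n l ih =>
    rw [CB_eq]
    refine le_sup_of_le_right (le_inf (inf_le_left.trans ?_) (le_iSup_of_le n ?_))
    · simpa [seqCode] using valid_append_le (τ := τ) (l := []) (c := n) (r := l)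
    · refine le_of_le_iSup (le_top.trans (iSup_isSub hM τ n).ge) fun ρ => ?_
      refine le_iSup_of_le ρ (le_inf inf_le_right ?_)
      refine le_of_le_iSup (le_top.trans (iSup_isStd hM (pointFn l)).ge) fun β => ?_
      refine le_iSup_of_le β (le_inf ?_ (le_trans (le_inf ?_ inf_le_right) (ih ρ β)))
      · refine le_trans (le_inf ?_ inf_le_right) isStd_le_isShift
        exact inf_le_left.trans (inf_le_left.trans inf_le_right)
      · refine le_trans (le_inf ?_ ?_) (isSub_inf_valid_le (τ := τ) (n := n))
        · exact inf_le_left.trans inf_le_right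
        · exact inf_le_left.trans (inf_le_left.trans inf_le_left)

theorem CBStage_le (k : ℕ) (τ α : M.Elem) :
    M.CBStage k τ α ≤ ⨆ l, valid τ l ⊓ isStd α (pointFn l) := by
  induction k generalizing τ α with
  | zero => exact le_iSup_of_le [] (le_inf (by rw [valid_nil]; exact le_top) le_rfl)
  | succ k ih =>
    refine sup_le (le_iSup_of_le [] (le_inf (by rw [valid_nil]; exact le_top) le_rfl)) ?_
    simp only [subMem, inf_iSup_eq]
    refine iSup_le fun n => iSup_le fun ρ => iSup_le fun β => ?_
    refine le_of_le_iSup (inf_le_right.trans (inf_le_right.trans (inf_le_right.trans (ih ρ β))))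
      fun l => le_iSup_of_le (n :: l) (le_inf ?_ ?_)
    · refine le_trans (le_inf (le_inf ?_ ?_) ?_) (isSub_inf_valid_le' (ρ := ρ))
      · exact inf_le_left.trans inf_le_left
      · exact inf_le_left.trans (inf_le_right.trans inf_le_left)
      · exact inf_le_right.trans inf_le_left
    · refine le_trans (le_inf ?_ (inf_le_right.trans inf_le_right)) isShift_inf_isStd_le
      exact inf_le_left.trans (inf_le_right.trans (inf_le_right.trans inf_le_left))

/-- `Z` lies between `CB*_τ` and its closure. -/
structure CBLike (τ : M.Elem) (Z : M.Elem → H) : Prop where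
  point_mem : ∀ l δ, valid τ l ⊓ isStd δ (pointFn l) ≤ Z δ
  le_point : ∀ δ n, Z δ ≤ ⨆ l, valid τ l ⊓ M.passes δ (initial (pointFn l) n)

theorem CBLike_CB (hM : M.AC00) (τ : M.Elem) : CBLike τ (M.CB τ) where
  point_mem l δ := valid_inf_isStd_le_CB hM l τ δ
  le_point δ n := iSup_le fun k => (CBStage_le k τ δ).trans
    (iSup_mono fun _ => inf_le_inf_left _ (isStd_le_passes δ _ n))

theorem agree_comm (n : ℕ) (α β : M.Elem) : M.agree n α β = M.agree n β α := by
  simp only [agree, inf_comm]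

/-- `le_point` asks for approximation to a prescribed length only, and that survives taking the
closure. -/
theorem CBLike_cl (hM : M.AC00) (τ : M.Elem) : CBLike τ (M.cl (M.CB τ)) where
  point_mem _ δ := by
    refine le_iInf fun n => le_iSup_of_le δ (le_inf (valid_inf_isStd_le_CB hM _ τ δ) ?_)
    simp [agree, M.val_total]
  le_point δ n := by
    refine (iInf_le _ n).trans (iSup_le fun β => ?_)
    refine le_of_le_iSup (inf_le_left.trans ((CBLike_CB hM τ).le_point β n)) fun l => ?_
    refine le_iSup_of_le l (le_inf (inf_le_right.trans inf_le_left) ?_)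
    refine le_trans (le_inf ?_ (inf_le_right.trans inf_le_right))
      (agree_inf_passes (α := β) (n := n) (by simp))
    rw [agree_comm]
    exact inf_le_left.trans inf_le_right

/-! ### Points of the components of a sequence -/

theorem length_le_seqCode (l : List ℕ) : l.length ≤ seqCode l := by
  induction l with
  | nil => simp
  | cons n l ih =>
    have := Nat.right_le_pair n (seqCode l)
    simp only [seqCode, List.length_cons]
    omega

theorem lt_pairJ (n s : ℕ) : s < pairJ n s := Nat.lt_succ_of_le (Nat.right_le_pair n s)

theorem pairJ_injective {n n' s s' : ℕ} (h : pairJ n s = pairJ n' s') : n = n' ∧ s = s' := by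
  simpa [pairJ] using h

/-- The place in `α` where it is recorded whether the component of `α` with number `x.1` admits
the initial part of length `n` of the sequence that belongs to `x.2`. -/
def place (x : ℕ × List ℕ) (n : ℕ) : ℕ := pairJ x.1 (seqCode (initial (pointFn x.2) n))

theorem lt_place (x : ℕ × List ℕ) (n : ℕ) : n < place x n := by
  refine lt_of_le_of_lt ?_ (lt_pairJ _ _)
  simpa using length_le_seqCode (initial (pointFn x.2) n)

/-- Hence a kill of the point of `l` at length `n` kills all points that branch off from `l` through
a child `c ≥ n`. -/
theorem place_append (i : ℕ) (l r : List ℕ) {c n : ℕ} (h : n ≤ c) :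
    place (i, l ++ c :: r) n = place (i, l) n := by
  simp only [place]
  rw [initial_eq_iff.2 fun j hj => pointFn_append_of_lt l r (hj.trans_le h)]

/-- The component of `α` with number `x.1` admits the sequence that belongs to `x.2`. -/
def alive (α : M.Elem) (x : ℕ × List ℕ) : H := ⨅ n, M.val α (place x n) 0

/-- The finite sequence `u` does not exclude that the component with number `x.1` admits the
sequence that belongs to `x.2`. -/
def aliveAt (u : List ℕ) (x : ℕ × List ℕ) : Prop := ∀ n, u.getD (place x n) 0 = 0

/-- Where the new point differs from the old one, at lengths `n > c`, its places lie beyond the end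
of `u`, where nothing is excluded yet. Children with large numbers are thus alive for free. -/
theorem aliveAt_append {u : List ℕ} {i : ℕ} {l : List ℕ} (h : aliveAt u (i, l)) {c : ℕ}
    (hc : u.length ≤ c) : aliveAt u (i, l ++ [c]) := by
  intro n
  by_cases hn : n ≤ c
  · rw [place_append i l [] hn]
    exact h n
  · have := lt_place (i, l ++ [c]) n
    rw [List.getD_eq_default _ _ (by omega)]

theorem alive_le_subMem (hM : M.AC00) {τ : M.Elem} {Z : M.Elem → H} (hZ : CBLike τ Z)
    (α : M.Elem) (x : ℕ × List ℕ) :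
    valid τ x.2 ⊓ alive α x ≤ M.subMem (M.Share Z) α x.1 := by
  refine le_of_le_iSup (le_top.trans (iSup_isSub hM α x.1).ge) fun ρ => ?_
  refine le_iSup_of_le ρ (le_inf inf_le_right ?_)
  refine le_of_le_iSup (le_top.trans (iSup_isStd hM (pointFn x.2)).ge) fun δ => ?_
  refine le_iSup_of_le δ (le_inf (le_trans (le_inf ?_ inf_le_right) (hZ.point_mem x.2 δ)) ?_)
  · exact inf_le_left.trans (inf_le_left.trans inf_le_left)
  · refine le_iInf fun w => le_himp_iff.2 ?_
    by_cases hb : valid τ x.2 ⊓ alive α x ⊓ M.isSub α x.1 ρ ⊓ isStd δ (pointFn x.2) ⊓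
      M.passes δ w = ⊥
    · rw [hb]; exact bot_le
    · have hw := eq_initial_of_passes hb (inf_le_left.trans inf_le_right) inf_le_right
      rw [hw]
      refine le_trans (inf_le_left.trans (inf_le_left.trans (le_inf inf_le_right
        (inf_le_left.trans (inf_le_right.trans (iInf_le _ w.length))))))
        (isSub_inf_val_le' (σ := α) (n := x.1))

/-- If a component of `α` belongs to `Share Z`, then it admits a sequence. -/
theorem subMem_Share_le (Z : M.Elem → H) (α : M.Elem) (i : ℕ) :
    M.subMem (M.Share Z) α i ≤
      ⨆ δ, Z δ ⊓ ⨅ w, M.passes δ w ⇨ M.val α (pairJ i (seqCode w)) 0 := by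
  refine iSup_le fun ρ => ?_
  simp only [Share, inf_iSup_eq]
  refine iSup_le fun δ => le_iSup_of_le δ (le_inf (inf_le_right.trans inf_le_left)
    (le_iInf fun w => le_himp_iff.2 ?_))
  refine le_trans (le_inf (inf_le_left.trans inf_le_left) ?_) (isSub_inf_val_le (ρ := ρ))
  exact le_himp_iff.1 (inf_le_right.trans (inf_le_right.trans (iInf_le _ w)))

theorem iSup_elim {ι : Sort*} {q c : H} {a : ι → H} (h : q ≤ ⨆ i, a i)
    (hi : ∀ i, ∀ q' ≤ q, q' ≤ a i → q' ≤ c) : q ≤ c :=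
  le_of_le_iSup h fun i => hi i _ inf_le_left inf_le_right

theorem himp_intro {q a b : H} (h : ∀ q' ≤ q, q' ≤ a → q' ≤ b) : q ≤ a ⇨ b :=
  le_himp_iff.2 (h _ inf_le_left inf_le_right)

theorem himp_elim {q a b : H} (h : q ≤ a ⇨ b) (ha : q ≤ a) : q ≤ b := (le_inf h ha).trans himp_inf_le

/-! ### A stump above a given one that is closed under natural sums -/

/-- `u` is a node of `σ`, and `σ` is not empty at `u`. -/
def innerNode (σ : M.Elem) (u : List ℕ) : H := valid σ (u ++ [0])

theorem innerNode_le_val (σ : M.Elem) (u : List ℕ) : innerNode σ u ≤ M.val σ (seqCode u) 0 :=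
  valid_append_le

/-- `valid` inspects proper prefixes only, so the last entry is irrelevant; in particular the `0` in
`innerNode` is an arbitrary choice. -/
theorem valid_append_eq (σ : M.Elem) (u : List ℕ) (n : ℕ) :
    valid σ (u ++ [n]) = innerNode σ u := by
  apply le_antisymm
  · exact le_valid_append (valid_anti (List.prefix_append _ _)) valid_append_le
  · exact le_valid_append (valid_anti (List.prefix_append _ _)) valid_append_le

theorem innerNode_anti {σ : M.Elem} {u u' : List ℕ} (h : u' <+: u) :
    innerNode σ u ≤ innerNode σ u' := by
  obtain ⟨t, rfl⟩ := h
  cases t with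
  | nil => simp
  | cons n t =>
    rw [← valid_append_eq σ u' n]
    exact valid_anti ⟨t ++ [0], by simp⟩

theorem isComplemented_valid (σ : M.Elem) (u : List ℕ) : IsComplemented (valid σ u) := by
  have := isComplemented_iInf Finset.univ
    (fun i : Fin u.length => M.val σ (seqCode (u.take i)) 0) fun i _ => isComplemented_val _ _ _
  simpa [valid] using this

theorem Definable.valid {k : ℕ} (i : Fin k) (l : List ℕ) :
    M.Definable k (fun x => valid (x i) l) :=
  Definable.allCountable fun _ => Definable.val _ _ _

/-- The coordinate that is changed by the move `c`. -/
def moveCoord (c : ℕ) : ℕ := c.unpair.1.unpair.1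

/-- The direction of the move `c`. -/
def moveDir (c : ℕ) : ℕ := c.unpair.1.unpair.2

/-- The number of coordinates at the node `l`, chosen by the first move. -/
def bound (l : List ℕ) : ℕ := (l.headD 0).unpair.1

/-- The coordinate with number `p` at the node `l`: a finite sequence, to be thought of as a node
of `σ`. -/
def coord (l : List ℕ) (p : ℕ) : List ℕ :=
  (l.tail.filter fun c => moveCoord c = p).map moveDir

theorem bound_append {l : List ℕ} (hl : l ≠ []) (c : ℕ) : bound (l ++ [c]) = bound l := by
  cases l with
  | nil => exact absurd rfl hl
  | cons a l => rfl

/-- The part `c.unpair.2` of a later move has no effect. Each position is therefore reached through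
infinitely many siblings, and this free part will carry the labels. -/
theorem coord_append {l : List ℕ} (hl : l ≠ []) (c p : ℕ) :
    coord (l ++ [c]) p = coord l p ++ if moveCoord c = p then [moveDir c] else [] := by
  cases l with
  | nil => exact absurd rfl hl
  | cons a l =>
    simp only [coord, List.cons_append, List.tail_cons, List.filter_append, List.map_append]
    by_cases h : moveCoord c = p <;> simp [h]

theorem coord_singleton (c p : ℕ) : coord [c] p = [] := rfl

/-- The move `c` is allowed at the node `l`. -/
def moveOK (σ : M.Elem) (l : List ℕ) (c : ℕ) : H :=
  ⨅ _ : l ≠ [], ⨆ _ : moveCoord c < bound l, innerNode σ (coord l (moveCoord c))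

/-- All moves made on the way to the node `l` are allowed. -/
def legal (σ : M.Elem) (l : List ℕ) : H :=
  ⨅ i : Fin l.length, moveOK σ (l.take i) (l.get i)

/-- The tree is not empty at the node `l`: all moves made were allowed, and some move can still
be made. -/
def canMove (σ : M.Elem) (l : List ℕ) : H :=
  ⨅ _ : l ≠ [], legal σ l ⊓ ⨆ p : Fin (bound l), innerNode σ (coord l p)

theorem legal_append (σ : M.Elem) (l : List ℕ) (c : ℕ) :
    legal σ (l ++ [c]) = legal σ l ⊓ moveOK σ l c := by
  apply le_antisymm
  · refine le_inf (le_iInf fun i => ?_) ?_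
    · refine (iInf_le _ (⟨i, by simp⟩ : Fin (l ++ [c]).length)).trans (le_of_eq ?_)
      simp [List.take_append_of_le_length i.2.le, List.getElem_append_left i.2]
    · refine (iInf_le _ (⟨l.length, by simp⟩ : Fin (l ++ [c]).length)).trans (le_of_eq ?_)
      simp
  · refine le_iInf fun ⟨i, hi⟩ => ?_
    simp only [List.length_append, List.length_singleton] at hi
    rcases Nat.lt_succ_iff_lt_or_eq.1 hi with h | rfl
    · refine inf_le_left.trans ((iInf_le _ (⟨i, h⟩ : Fin l.length)).trans (le_of_eq ?_))
      simp [List.take_append_of_le_length h.le, List.getElem_append_left h]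
    · refine inf_le_right.trans (le_of_eq ?_)
      simp

theorem legal_singleton (σ : M.Elem) (c : ℕ) : legal σ [c] = ⊤ := by
  simp [legal, moveOK]

theorem canMove_nil (σ : M.Elem) : canMove σ [] = ⊤ := by simp [canMove]

theorem canMove_le_legal {σ : M.Elem} {l : List ℕ} (hl : l ≠ []) : canMove σ l ≤ legal σ l :=
  (iInf_le _ hl).trans inf_le_left

theorem canMove_le_innerNode {σ : M.Elem} {l : List ℕ} (hl : l ≠ []) :
    canMove σ l ≤ ⨆ p : Fin (bound l), innerNode σ (coord l p) :=
  (iInf_le _ hl).trans inf_le_right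

theorem le_canMove {σ : M.Elem} {q : H} {l : List ℕ} (h : q ≤ legal σ l) {p : ℕ}
    (hp : p < bound l) (h' : q ≤ innerNode σ (coord l p)) : q ≤ canMove σ l :=
  le_iInf fun _ => le_inf h (h'.trans (le_iSup (fun p : Fin (bound l) => innerNode σ (coord l p))
    ⟨p, hp⟩))

theorem le_moveOK {σ : M.Elem} {q : H} {l : List ℕ} {c : ℕ} (hp : moveCoord c < bound l)
    (h : q ≤ innerNode σ (coord l (moveCoord c))) : q ≤ moveOK σ l c :=
  le_iInf fun _ => h.trans (le_iSup_of_le hp le_rfl)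

theorem moveOK_elim {σ : M.Elem} {q : H} (hq : q ≠ ⊥) {l : List ℕ} (hl : l ≠ []) {c : ℕ}
    (h : q ≤ moveOK σ l c) :
    moveCoord c < bound l ∧ q ≤ innerNode σ (coord l (moveCoord c)) := by
  have h1 := h.trans (iInf_le _ hl)
  by_cases hc : moveCoord c < bound l
  · simp only [hc, iSup_true] at h1
    exact ⟨hc, h1⟩
  · simp only [hc, iSup_false, le_bot_iff] at h1
    exact absurd h1 hq

/-- Only finitely many decidable conditions on `σ` are involved. This is what lets choice produce a
sequence `τ` with values `0` and `1`. -/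
theorem isComplemented_canMove (σ : M.Elem) (l : List ℕ) : IsComplemented (canMove σ l) := by
  have hm : ∀ l c, IsComplemented (moveOK σ l c) := by
    intro l c
    by_cases h1 : l = []
    · simpa [moveOK, h1] using isComplemented_top
    · by_cases h2 : moveCoord c < bound l
      · simpa [moveOK, h1, h2, innerNode] using isComplemented_valid σ (coord l (moveCoord c) ++ [0])
      · simpa [moveOK, h1, h2] using isComplemented_bot
  have hleg : IsComplemented (legal σ l) := by
    simpa [legal] using isComplemented_iInf Finset.univ
      (fun i : Fin l.length => moveOK σ (l.take i) (l.get i)) fun i _ => hm _ _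
  have hsup : IsComplemented (⨆ p : Fin (bound l), innerNode σ (coord l p)) := by
    simpa using isComplemented_iSup Finset.univ
      (fun p : Fin (bound l) => innerNode σ (coord l p)) fun i _ => isComplemented_valid _ _
  by_cases h : l = []
  · simpa [canMove, h] using isComplemented_top
  · simpa [canMove, h] using hleg.inf hsup

theorem Definable.allProp {k : ℕ} {P : Prop} {φ : (Fin k → M.Elem) → H}
    (h : M.Definable k φ) : M.Definable k (fun x => ⨅ _ : P, φ x) := by
  by_cases hP : P
  · simpa [hP] using h
  · simpa [hP] using Definable.top M k

theorem Definable.canMove {k : ℕ} (i : Fin k) (l : List ℕ) :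
    M.Definable k (fun x => canMove (x i) l) :=
  Definable.allProp (Definable.and
    (Definable.allCountable fun _ => Definable.allProp (Definable.exProp (Definable.valid _ _)))
    (Definable.exCountable fun _ => Definable.valid _ _))

/-- `τ` is the stump that is built from `σ` in this way. -/
def isSumStump (σ τ : M.Elem) : H :=
  ⨅ l, (canMove σ l ⇨ M.val τ (seqCode l) 0) ⊓ (M.val τ (seqCode l) 0 ⇨ canMove σ l)

theorem iSup_isSumStump (hM : M.AC00) (σ : M.Elem) : ⨆ τ, isSumStump σ τ = ⊤ := by
  have := hM 1 (fun s v x => ⨆ l, ⨆ _ : seqCode l = s, (⨆ _ : v = 0, canMove (x 0) l) ⊔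
      ⨆ _ : v = 1, (canMove (x 0) l ⇨ ⊥))
    (fun m n => Definable.exCountable fun l => Definable.exProp (Definable.or
      (Definable.exProp (Definable.canMove _ _))
      (Definable.exProp (Definable.imp (Definable.canMove _ _) Definable.bot)))) ![σ]
  rw [← top_le_iff]
  refine le_trans (le_iInf fun s => ?_)
    (this.trans (iSup_mono fun τ => le_iInf fun l => ?_))
  · obtain ⟨l, rfl⟩ := seqCode_bijective.2 s
    have hc := sup_compl_eq_top (isComplemented_canMove σ l)
    rw [← hc]
    refine sup_le (le_iSup_of_le 0 (le_iSup_of_le l ?_)) (le_iSup_of_le 1 (le_iSup_of_le l ?_))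
    · simp
    · simp
  · have key : ∀ q : H, q ≤ (⨅ m, ⨆ n, M.val τ m n ⊓ ⨆ l, ⨆ _ : seqCode l = m,
        (⨆ _ : n = 0, canMove σ l) ⊔ ⨆ _ : n = 1, (canMove σ l ⇨ ⊥)) →
        ∀ c, (∀ q' ≤ q, q' ≤ M.val τ (seqCode l) 0 → q' ≤ canMove σ l → q' ≤ c) →
        (∀ q' ≤ q, q' ≤ M.val τ (seqCode l) 1 → q' ≤ (canMove σ l)ᶜ → q' ≤ c) → q ≤ c := by
      intro q hq c h0 h1
      refine iSup_elim (hq.trans (iInf_le _ (seqCode l))) fun n q' hq' h => ?_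
      refine iSup_elim (h.trans inf_le_right) fun l' q1 hq1 h' => ?_
      refine iSup_elim h' fun hl q2 hq2 h2 => ?_
      obtain rfl := seqCode_bijective.1 hl
      rw [← inf_eq_left.2 h2, inf_sup_left]
      refine sup_le ?_ ?_
      · refine iSup_elim inf_le_right fun hn q3 hq3 h3 => ?_
        subst hn
        have : q3 ≤ q' := hq3.trans (inf_le_left.trans (hq2.trans hq1))
        exact h0 q3 (this.trans hq') (this.trans (h.trans inf_le_left)) h3
      · refine iSup_elim inf_le_right fun hn q3 hq3 h3 => ?_
        subst hn
        have : q3 ≤ q' := hq3.trans (inf_le_left.trans (hq2.trans hq1))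
        exact h1 q3 (this.trans hq') (this.trans (h.trans inf_le_left)) (h3.trans (himp_bot _).le)
    simp only [Matrix.cons_val_zero]
    refine le_inf (himp_intro fun q hq h => ?_) (himp_intro fun q hq h => ?_)
    · refine key q hq _ (fun q' _ h' _ => h') fun q' hq' _ h' => ?_
      have := le_inf (hq'.trans h) h'
      rw [inf_compl_self] at this
      exact this.trans bot_le
    · refine key q hq _ (fun q' _ _ h' => h') fun q' hq' h' _ => ?_
      have := le_inf (hq'.trans h) h'
      rw [M.val_unique _ _ _ _ (by decide : (0 : ℕ) ≠ 1)] at this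
      exact this.trans bot_le

/-- The coordinates at a node. -/
def coords (l : List ℕ) : Multiset (List ℕ) := (Multiset.range (bound l)).map (coord l)

theorem coords_append {l : List ℕ} (hl : l ≠ []) {c : ℕ} (hc : moveCoord c < bound l) :
    ∃ X, coords l = coord l (moveCoord c) ::ₘ X ∧
      coords (l ++ [c]) = {coord l (moveCoord c) ++ [moveDir c]} + X := by
  refine ⟨((Multiset.range (bound l)).erase (moveCoord c)).map (coord l), ?_, ?_⟩
  · rw [coords, ← Multiset.map_cons, Multiset.cons_erase (Multiset.mem_range.2 hc)]
  · rw [coords, bound_append hl]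
    conv_lhs => rw [← Multiset.cons_erase (Multiset.mem_range.2 hc)]
    rw [Multiset.map_cons, coord_append hl, if_pos rfl, Multiset.singleton_add]
    congr 1
    refine Multiset.map_congr rfl fun p hp => ?_
    have hne : p ≠ moveCoord c :=
      ((Multiset.nodup_range _).mem_erase_iff.1 hp).1
    rw [coord_append hl, if_neg hne.symm, List.append_nil]

/-! ### The sum stump is a stump and lies above `σ`. -/

section

variable {σ τ : M.Elem} {q : H} (hτ : q ≤ isSumStump σ τ)
include hτ

theorem val_of_canMove {l : List ℕ} (h : q ≤ canMove σ l) : q ≤ M.val τ (seqCode l) 0 :=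
  himp_elim (hτ.trans ((iInf_le _ l).trans inf_le_left)) h

theorem canMove_of_val {l : List ℕ} (h : q ≤ M.val τ (seqCode l) 0) : q ≤ canMove σ l :=
  himp_elim (hτ.trans ((iInf_le _ l).trans inf_le_right)) h

/-- The coordinates at a node form a multiset of nodes of `σ`, and a legal move replaces one of them
by an immediate successor. So the tree inherits accessibility from the multiset order. -/
theorem HAcc_sumStump (h : q ≤ HAcc (treeRel σ) []) : q ≤ HAcc (treeRel τ) [] := by
  have key : ∀ N, HAcc (multStep (treeRel σ)) N ≤
      ⨅ l : List ℕ, ⨅ _ : l ≠ [] ∧ coords l = N, isSumStump σ τ ⇨ HAcc (treeRel τ) l := by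
    refine HAcc_le (Q := fun N => ⨅ l : List ℕ, ⨅ _ : l ≠ [] ∧ coords l = N,
      isSumStump σ τ ⇨ HAcc (treeRel τ) l) fun N => ?_
    refine le_iInf₂ fun l ⟨hl, hN⟩ => himp_intro fun q hq hτ => ?_
    -- Two levels at once: `τ` records the legality of the move `c` only at the node `l ++ [c]`.
    -- After an illegal move the tree is empty there and nothing remains to be shown.
    refine le_HAcc_treeRel fun c => le_HAcc_treeRel fun n => ?_
    set q' := q ⊓ M.val τ (seqCode l) 0 ⊓ M.val τ (seqCode (l ++ [c])) 0
    have hq' : q' ≤ q := inf_le_left.trans inf_le_left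
    by_cases hb : q' = ⊥
    · rw [hb]; exact bot_le
    have h1 : q' ≤ canMove σ (l ++ [c]) := canMove_of_val (hq'.trans hτ) inf_le_right
    have h2 := h1.trans (canMove_le_legal (by simp))
    rw [legal_append] at h2
    obtain ⟨hc, h3⟩ := moveOK_elim hb hl (h2.trans inf_le_right)
    obtain ⟨X, hX, hX'⟩ := coords_append hl hc
    have h4 : q' ≤ multStep (treeRel σ) N (coords (l ++ [c])) := by
      rw [← hN, hX, hX']
      refine le_multStep _ _ _ fun y hy => ?_
      rw [Multiset.mem_singleton.1 hy, treeRel_append]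
      exact h3.trans (innerNode_le_val _ _)
    have h5 := himp_elim ((hq'.trans hq).trans (iInf_le _ (coords (l ++ [c])))) h4
    have h6 := himp_elim (h5.trans (iInf₂_le (l ++ [c]) ⟨by simp, rfl⟩)) (hq'.trans hτ)
    exact (le_inf h6 inf_le_right).trans
      ((inf_le_inf_left _ (treeRel_append τ (l ++ [c]) n).ge).trans (HAcc_inf_le _ _))
  refine le_HAcc_treeRel fun c => inf_le_left.trans ?_
  refine himp_elim ((le_HAcc_multStep (coords [c]) fun a ha => ?_).trans
    ((key _).trans (iInf₂_le [c] ⟨by simp, rfl⟩))) hτ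
  obtain ⟨p, _, rfl⟩ := Multiset.mem_map.1 ha
  exact h

/-- After the first move `Nat.pair 1 0` there is a single coordinate, and below that node the tree
contains a copy of `σ`. Hence `σ ≤ τ^n` for this `n`. -/
theorem le_sumStump (hM : M.AC00) (h : q ≤ HAcc (treeRel σ) []) : q ≤ M.lt σ τ := by
  have key : ∀ u, HAcc (treeRel σ) u ≤ ⨅ l : List ℕ,
      ⨅ _ : l ≠ [] ∧ bound l = 1 ∧ coord l 0 = u, ⨅ ρ, ⨅ ρ', isSumStump σ τ ⊓ legal σ l ⊓
        valid σ u ⊓ isSubAt σ u ρ ⊓ isSubAt τ l ρ' ⇨ M.le ρ ρ' := by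
    refine HAcc_le (Q := fun u => ⨅ l : List ℕ,
      ⨅ _ : l ≠ [] ∧ bound l = 1 ∧ coord l 0 = u, ⨅ ρ, ⨅ ρ', isSumStump σ τ ⊓ legal σ l ⊓
        valid σ u ⊓ isSubAt σ u ρ ⊓ isSubAt τ l ρ' ⇨ M.le ρ ρ') fun u => ?_
    refine le_iInf₂ fun l ⟨hl, hbd, hco⟩ => le_iInf₂ fun ρ ρ' => himp_intro fun q hq h => ?_
    obtain ⟨⟨⟨⟨hτ, hleg⟩, hv⟩, hρ⟩, hρ'⟩ : (((q ≤ isSumStump σ τ ∧ q ≤ legal σ l) ∧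
      q ≤ valid σ u) ∧ q ≤ isSubAt σ u ρ) ∧ q ≤ isSubAt τ l ρ' := by
      simpa only [le_inf_iff] using h
    rw [le_eq]
    refine iSup_elim (a := M.val ρ 0) (le_top.trans (M.val_total ρ 0).ge) fun p q1 hq1 hp => ?_
    cases p with
    | succ p => exact le_sup_of_le_left (hp.trans (le_iSup (fun p => M.val ρ 0 (p + 1)) p))
    | zero =>
      refine le_sup_of_le_right (le_inf hp (le_iInf fun n => ?_))
      have hu : q1 ≤ M.val σ (seqCode u) 0 := by
        rw [← catCode_zero]
        exact (le_inf (hq1.trans hρ) hp).trans isSubAt_inf_val_le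
      have hin : q1 ≤ innerNode σ u := le_valid_append (hq1.trans hv) hu
      refine iSup_elim (le_top.trans (iSup_isSub hM ρ n).ge) fun ρ1 q2 hq2 hρ1 => ?_
      refine le_iSup_of_le ρ1 (le_inf hρ1 ?_)
      change q2 ≤ M.lt ρ1 ρ'
      rw [lt_eq]
      have h20 : q2 ≤ q := hq2.trans hq1
      -- The witness is the move of coordinate `0` in direction `n`, with idle part `0`.
      refine le_inf ?_ (le_iSup_of_le (Nat.pair (Nat.pair 0 n) 0) ?_)
      · refine (le_inf (h20.trans hρ') ?_).trans isSubAt_inf_val_le'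
        rw [catCode_zero]
        refine val_of_canMove (h20.trans hτ) (le_canMove (h20.trans hleg) (p := 0) (by omega) ?_)
        rw [hco]
        exact hq2.trans hin
      · set c := Nat.pair (Nat.pair 0 n) 0
        have hc1 : moveCoord c = 0 := by simp [c, moveCoord]
        have hc2 : moveDir c = n := by simp [c, moveDir]
        refine iSup_elim (le_top.trans (iSup_isSub hM ρ' c).ge) fun ρ2 q3 hq3 hρ2 => ?_
        refine le_iSup_of_le ρ2 (le_inf hρ2 ?_)
        have h30 : q3 ≤ q := hq3.trans h20
        have h1 := himp_elim ((h30.trans hq).trans (iInf_le _ (u ++ [n]))) (by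
          rw [treeRel_append]
          exact (hq3.trans hq2).trans hu)
        have h2 := h1.trans (iInf₂_le (l ++ [c]) ⟨by simp, by rw [bound_append hl, hbd], by
          rw [coord_append hl, if_pos hc1, hco, hc2]⟩)
        refine himp_elim (h2.trans ((iInf_le _ ρ1).trans (iInf_le _ ρ2))) ?_
        refine le_inf (le_inf (le_inf (le_inf (h30.trans hτ) ?_) ?_) ?_) ?_
        · rw [legal_append]
          refine le_inf (h30.trans hleg) (le_moveOK (by omega) ?_)
          rw [hc1, hco]
          exact (hq3.trans hq2).trans hin
        · rw [valid_append_eq]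
          exact (hq3.trans hq2).trans hin
        · exact (le_inf (h30.trans hρ) (hq3.trans hρ1)).trans (isSubAt_inf_isSub_le _ _ _ _ _)
        · exact (le_inf (h30.trans hρ') hρ2).trans (isSubAt_inf_isSub_le _ _ _ _ _)
  rw [lt_eq]
  refine le_inf (val_of_canMove hτ (l := []) (by rw [canMove_nil]; exact le_top))
    (le_iSup_of_le (Nat.pair 1 0) ?_)
  refine iSup_elim (le_top.trans (iSup_isSub hM τ (Nat.pair 1 0)).ge) fun ρ q1 hq1 hρ => ?_
  refine le_iSup_of_le ρ (le_inf hρ ?_)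
  have h1 := (hq1.trans h).trans ((key []).trans (iInf₂_le [Nat.pair 1 0]
    ⟨by simp, by simp [bound], rfl⟩))
  refine himp_elim (h1.trans ((iInf_le _ σ).trans (iInf_le _ ρ))) ?_
  rw [legal_singleton, valid_nil, isSubAt_nil]
  refine le_inf (le_inf (le_inf (le_inf (hq1.trans hτ) le_top) le_top) le_top) ?_
  refine (le_inf le_top hρ).trans ((inf_le_inf_right _ (isSubAt_nil τ).ge).trans
    (isSubAt_inf_isSub_le τ τ ρ [] _))

end

/-! ### Values of coded continuous functions -/

theorem isValue_inf_isValue {γ α : M.Elem} {n p p' : ℕ} (h : p ≠ p') :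
    M.isValue γ α n p ⊓ M.isValue γ α n p' = ⊥ := by
  by_contra hb
  obtain ⟨l, h1⟩ := exists_inf_ne_bot hb inf_le_left
  obtain ⟨l', h2⟩ := exists_inf_ne_bot h1 (inf_le_left.trans inf_le_right)
  set q := M.isValue γ α n p ⊓ M.isValue γ α n p' ⊓
    (M.passes α l ⊓ M.val γ (pairJ n (seqCode l)) (p + 1) ⊓
      ⨅ i : Fin l.length, M.val γ (pairJ n (seqCode (l.take i))) 0) ⊓
    (M.passes α l' ⊓ M.val γ (pairJ n (seqCode l')) (p' + 1) ⊓
      ⨅ i : Fin l'.length, M.val γ (pairJ n (seqCode (l'.take i))) 0)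
  have a1 : q ≤ M.passes α l := inf_le_left.trans (inf_le_right.trans (inf_le_left.trans inf_le_left))
  have a2 : q ≤ M.val γ (pairJ n (seqCode l)) (p + 1) :=
    inf_le_left.trans (inf_le_right.trans (inf_le_left.trans inf_le_right))
  have a3 : ∀ i : Fin l.length, q ≤ M.val γ (pairJ n (seqCode (l.take i))) 0 := fun i =>
    inf_le_left.trans (inf_le_right.trans (inf_le_right.trans (iInf_le _ i)))
  have b1 : q ≤ M.passes α l' := inf_le_right.trans (inf_le_left.trans inf_le_left)
  have b2 : q ≤ M.val γ (pairJ n (seqCode l')) (p' + 1) :=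
    inf_le_right.trans (inf_le_left.trans inf_le_right)
  have b3 : ∀ i : Fin l'.length, q ≤ M.val γ (pairJ n (seqCode (l'.take i))) 0 := fun i =>
    inf_le_right.trans (inf_le_right.trans (iInf_le _ i))
  rcases lt_trichotomy l.length l'.length with hl | hl | hl
  · have := List.prefix_iff_eq_take.1 (prefix_of_le_passes h2 a1 b1 hl.le)
    have h3 := b3 ⟨l.length, hl⟩
    simp only [← this] at h3
    exact absurd (eq_of_le_val h2 a2 h3) (by omega)
  · have := (prefix_of_le_passes h2 a1 b1 hl.le).eq_of_length hl
    subst this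
    exact h (by have := eq_of_le_val h2 a2 b2; omega)
  · have := List.prefix_iff_eq_take.1 (prefix_of_le_passes h2 b1 a1 hl.le)
    have h3 := a3 ⟨l'.length, hl⟩
    simp only [← this] at h3
    exact absurd (eq_of_le_val h2 b2 h3) (by omega)

/-- A search along `l` for the first nonzero value: `m` initial parts have already been found to
give `0`, and `j` counts the remaining steps. -/
theorem le_iSup_isValue {γ α : M.Elem} {n : ℕ} {l : List ℕ} (j : ℕ) {q : H} {m : ℕ}
    (hm : m + j = l.length) (h1 : q ≤ M.passes α l)
    (h2 : q ≤ M.nonzero γ (pairJ n (seqCode l)))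
    (h3 : ∀ i < m, q ≤ M.val γ (pairJ n (seqCode (l.take i))) 0) :
    q ≤ ⨆ p, M.isValue γ α n p := by
  induction j generalizing q m with
  | zero =>
    refine iSup_elim h2 fun p q' hq' hp => le_iSup_of_le p (le_iSup_of_le l ?_)
    exact le_inf (le_inf (hq'.trans h1) hp) (le_iInf fun i => hq'.trans (h3 i (by omega)))
  | succ j ih =>
    refine iSup_elim (le_top.trans (M.val_total γ (pairJ n (seqCode (l.take m)))).ge)
      fun p q' hq' hp => ?_
    cases p with
    | zero =>
      refine ih (m := m + 1) (by omega) (hq'.trans h1) (hq'.trans h2) fun i hi => ?_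
      rcases Nat.lt_succ_iff_lt_or_eq.1 hi with hi | rfl
      · exact hq'.trans (h3 i hi)
      · exact hp
    | succ p =>
      refine le_iSup_of_le p (le_iSup_of_le (l.take m) (le_inf (le_inf ?_ hp) (le_iInf fun i => ?_)))
      · exact (hq'.trans h1).trans (passes_anti (List.take_prefix m l))
      · have hi : (i : ℕ) < m := i.2.trans_le (by simp)
        rw [List.take_take, min_eq_left hi.le]
        exact hq'.trans (h3 i hi)

theorem isFun_le_iSup_isValue {γ : M.Elem} (α : M.Elem) (n : ℕ) :
    M.isFun γ ≤ ⨆ p, M.isValue γ α n p := by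
  refine iSup_elim ((iInf_le _ n).trans (iInf_le _ α)) fun l q _ h => ?_
  exact le_iSup_isValue (m := 0) l.length (by simp) (h.trans inf_le_left) (h.trans inf_le_right)
    (by simp)

/-- A value is determined by an initial part of the argument. -/
theorem exists_forall_isValue {γ α : M.Elem} {n p : ℕ} {q : H} (hq : q ≠ ⊥)
    (h : q ≤ M.isValue γ α n p) : ∃ q' ≤ q, q' ≠ ⊥ ∧ ∃ l, q' ≤ M.passes α l ∧
      ∀ β, q' ⊓ M.passes β l ≤ M.isValue γ β n p := by
  obtain ⟨l, hl⟩ := exists_inf_ne_bot hq h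
  refine ⟨_, inf_le_left, hl, l, inf_le_right.trans (inf_le_left.trans inf_le_left), fun β => ?_⟩
  refine le_iSup_of_le l (le_inf (le_inf inf_le_right ?_) ?_)
  · exact inf_le_left.trans (inf_le_right.trans (inf_le_left.trans inf_le_right))
  · exact inf_le_left.trans (inf_le_right.trans inf_le_right)

/-! ### Brouwer's principle -/

/-- The first nonzero element of `w` is `t + 1`. -/
def signals (w : List ℕ) (t : ℕ) : Prop := w.find? (fun a => a ≠ 0) = some (t + 1)

theorem signals_of_prefix {w w' : List ℕ} {t : ℕ} (h : w <+: w') (hw : signals w t) :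
    signals w' t := by
  obtain ⟨r, rfl⟩ := h
  unfold signals at *
  rw [List.find?_append, hw]
  rfl

/-- The first nonzero value of `ζ` is not `t + 1`. -/
def neverSignals (ζ : M.Elem) (t : ℕ) : H := ⨅ (w : List ℕ) (_ : signals w t), (M.passes ζ w)ᶜ

/-- It cannot be decided for every `ζ` of which number `t + 1` it is not the first nonzero
value. -/
theorem iInf_iSup_neverSignals (hM : M.AC00) (hB : M.BCP) :
    ⨅ ζ : M.Elem, ⨆ t, neverSignals ζ t = ⊥ := by
  have hdef : ∀ t, M.Definable 1 (fun x => neverSignals (x 0) t) := fun t =>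
    Definable.allCountable fun w => Definable.allProp (by
      simpa using Definable.imp (Definable.passes (M := M) (0 : Fin 1) w) Definable.bot)
  have := hB 0 (fun t x => neverSignals (x 0) t) hdef Fin.elim0
  simp only [Fin.cons_zero] at this
  by_contra hq
  obtain ⟨α, hα⟩ := exists_inf_ne_bot hq (le_top.trans (iSup_isStd hM fun _ => 0).ge)
  obtain ⟨m, h1⟩ := exists_inf_ne_bot hα (inf_le_left.trans (this.trans (iInf_le _ α)))
  obtain ⟨t, h2⟩ := exists_inf_ne_bot h1 inf_le_right
  -- This sequence agrees with the zero sequence up to the modulus `m` and signals `t` immediately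
  -- afterwards.
  set f : ℕ → ℕ := fun i => if i = m then t + 1 else 0
  obtain ⟨β, h3⟩ := exists_inf_ne_bot h2 (le_top.trans (iSup_isStd hM f).ge)
  refine h3 (le_bot_iff.1 ?_)
  have h00 : initial f m = initial (fun _ => 0) m :=
    initial_eq_iff.2 fun i hi => by simp [f, Nat.ne_of_lt hi]
  have hsig : signals (initial f (m + 1)) t := by
    have h0 : initial f (m + 1) = initial (fun _ => 0) m ++ [t + 1] := by
      rw [initial, List.range_succ, List.map_append, ← initial,
        h00]
      simp [f]
    rw [signals, h0, List.find?_append]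
    have : (initial (fun _ => 0) m).find? (fun a => a ≠ 0) = none := by
      simp [initial]
    rw [this]
    simp
  refine le_trans (le_inf ?_ (inf_le_right.trans (isStd_le_passes β f (m + 1)))) himp_inf_le
  have hagree : isStd α (fun _ => 0) ⊓ isStd β f ≤ M.agree m α β := by
    refine le_trans (inf_le_inf (isStd_le_passes α _ m) (isStd_le_passes β f m)) ?_
    rw [h00]
    simpa using passes_inf_passes_le_agree (α := α) (β := β) (l := initial (fun _ => 0) m)
  have h4 : ∀ q', q' ≤ (⨅ β, M.agree m α β ⇨ neverSignals β t) → q' ≤ isStd α (fun _ => 0) →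
      q' ≤ isStd β f → q' ≤ neverSignals β t := fun q' a b c =>
    himp_elim (a.trans (iInf_le (fun β => M.agree m α β ⇨ neverSignals β t) β))
      ((le_inf b c).trans hagree)
  exact (h4 _ (inf_le_left.trans inf_le_right)
    (inf_le_left.trans (inf_le_left.trans (inf_le_left.trans inf_le_right))) inf_le_right).trans
    ((iInf₂_le (f := fun w _ => (M.passes β w)ᶜ) _ hsig).trans (himp_bot _).ge)

/-! ### Excluding values of a reduction -/

/-- For every `β` that passes through `u`, the image of `β` under `γ` excludes that the component
with number `x.1` admits an initial part of length at most `n₀` of the sequence that belongs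
to `x.2`. -/
def dead (γ : M.Elem) (n₀ : ℕ) (q : H) (u : List ℕ) (x : ℕ × List ℕ) : Prop :=
  ∃ n ≤ n₀, ∃ y, ∀ β, q ⊓ M.passes β u ≤ M.isValue γ β (place x n) (y + 1)

theorem dead_mono {γ : M.Elem} {n₀ n₁ : ℕ} {q q' : H} {u u' : List ℕ} {x : ℕ × List ℕ}
    (h : dead γ n₀ q u x) (hn : n₀ ≤ n₁) (hq : q' ≤ q) (hu : u <+: u') : dead γ n₁ q' u' x := by
  obtain ⟨n, h1, y, h2⟩ := h
  exact ⟨n, h1.trans hn, y, fun β => (inf_le_inf hq (passes_anti hu)).trans (h2 β)⟩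

open Classical in
/-- The value at `w.length` of the sequence that is controlled by a sequence with initial
part `w`. The sequence passes through `u`; then it excludes everything except the points in `B`
and those points in `A` whose label has not been signalled. -/
noncomputable def controlFn (u : List ℕ) (A B : Finset (ℕ × List ℕ)) (lab : ℕ × List ℕ → ℕ) (w : List ℕ) : ℕ :=
  if w.length < u.length then u.getD w.length 0
  else if (∃ x ∈ B, ∃ m, place x m = w.length) ∨
    ∃ x ∈ A, ∃ m, place x m = w.length ∧ ¬ signals (w.take m) (lab x) then 0 else 1

/-- Beyond `u`, the controlled sequence has the value `0` only at places of points in `B`, which lie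
in other components, and at places of points in `A` that have not been withdrawn. An admitted `δ`
must therefore follow such points of `A`. -/
theorem exists_of_controlFn {u : List ℕ} {A B : Finset (ℕ × List ℕ)} {lab : ℕ × List ℕ → ℕ}
    {ζ β δ : M.Elem} {q : H} (hq : q ≠ ⊥) {i : ℕ} (hB : ∀ x ∈ B, x.1 ≠ i)
    (h : q ≤ isTrans (controlFn u A B lab) ζ β)
    (hadm : q ≤ ⨅ w, M.passes δ w ⇨ M.val β (pairJ i (seqCode w)) 0)
    {y : List ℕ} (hy : q ≤ M.passes δ y) (hu : u.length ≤ y.length) :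
    ∃ a ∈ A, a.1 = i ∧ initial (pointFn a.2) y.length = y ∧
      ∀ w, q ≤ M.passes ζ w → w.length ≤ y.length → ¬ signals w (lab a) := by
  have hlen : y.length < pairJ i (seqCode y) :=
    (length_le_seqCode y).trans_lt (lt_pairJ _ _)
  obtain ⟨z, hz, hqz⟩ := exists_inf_passes_ne_bot hq ζ (pairJ i (seqCode y))
  have h1 : q ⊓ M.passes ζ z ≤ M.val β (pairJ i (seqCode y)) (controlFn u A B lab z) := by
    rw [← hz]
    exact (inf_le_inf_right _ h).trans isTrans_inf_passes_le
  have h2 : q ⊓ M.passes ζ z ≤ M.val β (pairJ i (seqCode y)) 0 :=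
    inf_le_left.trans (himp_elim (hadm.trans (iInf_le _ y)) hy)
  have h3 := eq_of_le_val hqz h1 h2
  rw [controlFn, if_neg (by omega)] at h3
  simp only [ite_eq_left_iff, one_ne_zero, imp_false, not_not] at h3
  rcases h3 with ⟨x, hx, m, hm⟩ | ⟨a, ha, m, hm, hs⟩
  · rw [hz] at hm
    exact absurd (pairJ_injective hm).1 (hB x hx)
  · rw [hz] at hm
    obtain ⟨h4, h5⟩ := pairJ_injective hm
    have h6 := seqCode_bijective.1 h5
    have hm' : m = y.length := by rw [← h6]; simp
    subst hm'
    refine ⟨a, ha, h4, h6, fun w hw hwl hsw => hs (signals_of_prefix ?_ hsw)⟩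
    have h7 := prefix_of_le_passes hqz (inf_le_left.trans hw) inf_le_right (by omega)
    exact List.prefix_take_iff.2 ⟨h7, hwl⟩

theorem exists_separation (A : Finset (ℕ × List ℕ)) (N : ℕ) : ∃ m ≥ N, ∀ a ∈ A, ∀ b ∈ A,
    initial (pointFn a.2) m = initial (pointFn b.2) m → a.2 = b.2 := by
  have h : ∀ a b : ℕ × List ℕ, ∃ m, ∀ m' ≥ m,
      initial (pointFn a.2) m' = initial (pointFn b.2) m' → a.2 = b.2 := by
    intro a b
    by_cases hab : a.2 = b.2
    · exact ⟨0, fun _ _ _ => hab⟩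
    · obtain ⟨i, hi⟩ := Function.ne_iff.1 (pointFn_injective.ne hab)
      exact ⟨i + 1, fun m' hm' he => absurd (initial_eq_iff.1 he i hm') hi⟩
  choose g hg using h
  refine ⟨max N ((A ×ˢ A).sup fun p => g p.1 p.2), le_max_left _ _, fun a ha b hb => hg a b _ ?_⟩
  exact le_max_of_le_right (Finset.le_sup (f := fun p : (ℕ × List ℕ) × (ℕ × List ℕ) => g p.1 p.2)
    (Finset.mk_mem_product ha hb))

/-! ### Killing finitely many target points. -/

section kill

variable {γ : M.Elem} {k : ℕ} {X Y : M.Elem → H} {I : Set ℕ} {lab : ℕ × List ℕ → ℕ}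
  {B : Finset (ℕ × List ℕ)}

/-- If the points in `A` and `B` are alive at `u`, then some point `d j` can be killed while all
points in `B` and all points in `A` except those with one label `t` are kept alive. -/
theorem exists_dead (hM : M.AC00) (hBCP : M.BCP) {q : H} (hq : q ≠ ⊥) (hfun : q ≤ M.isFun γ)
    (hred : ∀ β, q ⊓ M.imageMem Y γ β ≤ X β)
    (hX : ∀ β, X β ≤ ⨆ i, ⨆ _ : i ∈ I, ⨆ δ,
      ⨅ w, M.passes δ w ⇨ M.val β (pairJ i (seqCode w)) 0)
    {d : Fin k → ℕ × List ℕ} (hY : ∀ β, q ⊓ ⨅ j, alive β (d j) ≤ Y β)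
    {A : Finset (ℕ × List ℕ)} (hBI : ∀ x ∈ B, x.1 ∉ I) {u : List ℕ}
    (hA : ∀ x ∈ A, aliveAt u x) (hBu : ∀ x ∈ B, aliveAt u x) :
    ∃ q' ≤ q, q' ≠ ⊥ ∧ ∃ u', u <+: u' ∧ ∃ t j n₀,
      (∀ x ∈ A, lab x ≠ t → aliveAt u' x) ∧ (∀ x ∈ B, aliveAt u' x) ∧
        dead γ n₀ q' u' (d j) := by
  by_contra hno
  set F := controlFn u A B lab with hF
  -- If the image of a controlled `β` excluded some `d j`, the finite part of `β` responsible for it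
  -- would be the required `u'`, since by then at most one label has been signalled. So by `hno` the
  -- image never excludes any `d j`.
  have claim : ∀ ζ β j n, q ⊓ isTrans F ζ β ≤ M.isValue γ β (place (d j) n) 0 := by
    intro ζ β j n
    refine iSup_elim ((inf_le_left.trans hfun).trans (isFun_le_iSup_isValue β (place (d j) n)))
      fun y q1 hq1 hy => ?_
    cases y with
    | zero => exact hy
    | succ y =>
      by_cases hb : q1 = ⊥
      · rw [hb]; exact bot_le
      exfalso
      apply hno
      obtain ⟨q2, hq2, hb2, l, hl, hl'⟩ := exists_forall_isValue hb hy
      set N := max l.length u.length with hN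
      obtain ⟨w, hw, hb3⟩ := exists_inf_passes_ne_bot hb2 ζ N
      set q3 := q2 ⊓ M.passes ζ w
      have h32 : q3 ≤ q2 := inf_le_left
      have h3 : q3 ≤ q ⊓ isTrans F ζ β := h32.trans (hq2.trans hq1)
      -- Continuing `w` by zeros allows the initial part of `β` to be computed externally.
      set g : ℕ → ℕ := fun i => w.getD i 0 with hg
      set f : ℕ → ℕ := fun s => F (initial g s) with hf
      have hgw : initial g N = w := by rw [← hw]; exact initial_getD w
      have hpre : ∀ s ≤ N, initial g s <+: w := fun s hs => hgw ▸ initial_prefix g hs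
      have hβ : q3 ≤ M.passes β (initial f N) := by
        refine le_passes_iff.2 fun i hi => ?_
        rw [length_initial] at hi
        rw [getD_initial f hi]
        have h4 : q3 ≤ M.passes ζ (initial g i) :=
          inf_le_right.trans (passes_anti (hpre i hi.le))
        have h5 := (le_inf (h3.trans inf_le_right) h4).trans isTrans_inf_passes_le
        rwa [length_initial] at h5
      have hlf : l <+: initial f N :=
        prefix_of_le_passes hb3 (h32.trans hl) hβ (by simp [hN])
      have hfu : ∀ s < u.length, f s = u.getD s 0 := by
        intro s hs
        simp only [hf, hF, controlFn, length_initial, if_pos hs]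
      have huf : u <+: initial f N := by
        rw [← initial_getD u, ← initial_eq_iff.2 hfu]
        exact initial_prefix f (le_max_right _ _)
      have hzero : ∀ x n, (u.getD (place x n) 0 = 0) → (place x n < N → u.length ≤ place x n →
          f (place x n) = 0) → (initial f N).getD (place x n) 0 = 0 := by
        intro x n h1 h2
        by_cases h3 : place x n < N
        · rw [getD_initial f h3]
          by_cases h4 : place x n < u.length
          · rw [hfu _ h4, h1]
          · exact h2 h3 (not_lt.1 h4)
        · rw [List.getD_eq_default _ _ (by simpa using h3)]
      -- The lost label is the one signalled by the first nonzero entry of `w`. If there is no such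
      -- entry, the default `1` gives up label `0`, which does no harm.
      refine ⟨q3, h3.trans inf_le_left, hb3, initial f N, huf,
        (w.find? (fun a => a ≠ 0)).getD 1 - 1, j, n, fun x hx ht => ?_, fun x hx => ?_,
        n, le_rfl, y, fun β' => (inf_le_inf h32 (passes_anti hlf)).trans (hl' β')⟩
      · refine fun m => hzero x m (hA x hx m) fun h1 h2 => ?_
        simp only [hf, hF, controlFn, length_initial, if_neg (not_lt.2 h2)]
        refine if_pos (.inr ⟨x, hx, m, (length_initial _ _).symm, fun hs => ht ?_⟩)
        have hs' : signals w (lab x) :=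
          signals_of_prefix ((List.take_prefix _ _).trans (hpre _ h1.le)) hs
        rw [signals] at hs'
        rw [hs']
        simp
      · refine fun m => hzero x m (hBu x hx m) fun h1 h2 => ?_
        simp only [hf, hF, controlFn, length_initial, if_neg (not_lt.2 h2)]
        exact if_pos (.inl ⟨x, hx, m, (length_initial _ _).symm⟩)
  -- By the claim every controlled `β` has its image in `Y`, hence lies in `X`. The point that it
  -- admits reveals a label that `ζ` never signals; as `ζ` is arbitrary, Brouwer's principle is
  -- violated.
  refine hq (le_bot_iff.1 (iInf_iSup_neverSignals hM hBCP ▸ le_iInf fun ζ => ?_))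
  refine iSup_elim (le_top.trans (iSup_isTrans hM F ζ).ge) fun β q1 hq1 hβ => ?_
  have hval : ∀ j n, q1 ≤ M.isValue γ β (place (d j) n) 0 := fun j n =>
    (le_inf hq1 hβ).trans (claim ζ β j n)
  have himg : q1 ≤ M.imageMem Y γ β := by
    refine iSup_elim (isFun_le_iSup_isImage hM fun n =>
      (hq1.trans hfun).trans (isFun_le_iSup_isValue β n)) fun η q2 hq2 hη => ?_
    refine le_iSup_of_le η (le_inf hη ((le_inf (hq2.trans hq1) ?_).trans (hY η)))
    refine le_iInf fun j => le_iInf fun n => ?_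
    refine iSup_elim (hη.trans (iInf_le _ (place (d j) n))) fun p q3 hq3 hp => ?_
    by_cases h0 : p = 0
    · exact h0 ▸ hp.trans inf_le_right
    · refine le_trans ?_ bot_le
      rw [← isValue_inf_isValue h0]
      exact le_inf (hp.trans inf_le_left) ((hq3.trans hq2).trans (hval j n))
  refine iSup_elim ((le_inf hq1 himg).trans ((hred β).trans (hX β))) fun i q2 hq2 h2 => ?_
  refine iSup_elim h2 fun hi q3 hq3 h3 => ?_
  refine iSup_elim h3 fun δ q4 hq4 h4 => ?_
  have hβ4 : q4 ≤ isTrans F ζ β := hq4.trans (hq3.trans (hq2.trans hβ))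
  have hBi : ∀ x ∈ B, x.1 ≠ i := fun x hx he => hBI x hx (he ▸ hi)
  -- From length `m` on, an initial part of `δ` determines which point of `A` in the component `i`
  -- it follows, so the label found does not change later.
  obtain ⟨m, hmu, hm⟩ := exists_separation A u.length
  refine le_of_forall_passes δ m fun w hw => ?_
  by_cases hb : q4 ⊓ M.passes δ w = ⊥
  · rw [hb]; exact bot_le
  obtain ⟨a, ha, hai, haw, -⟩ := exists_of_controlFn hb hBi (inf_le_left.trans hβ4)
    (inf_le_left.trans h4) inf_le_right (by omega)
  refine le_iSup_of_le (lab a) (le_iInf₂ fun z hz => ?_)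
  rw [le_compl_iff_disjoint_right, disjoint_iff]
  by_contra hb1
  obtain ⟨y, hy, hb2⟩ := exists_inf_passes_ne_bot hb1 δ (max m z.length)
  have h5 : q4 ⊓ M.passes δ w ⊓ M.passes ζ z ⊓ M.passes δ y ≤ q4 :=
    inf_le_left.trans (inf_le_left.trans inf_le_left)
  obtain ⟨b, hb', hbi, hby, hbs⟩ := exists_of_controlFn hb2 hBi (h5.trans hβ4)
    (h5.trans h4) inf_le_right (by omega)
  have hwy : w <+: y := prefix_of_le_passes hb2
    (inf_le_left.trans (inf_le_left.trans inf_le_right)) inf_le_right (by omega)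
  have hbm : initial (pointFn b.2) m = w := by
    have h6 := List.prefix_iff_eq_take.1 hwy
    have h7 := List.prefix_iff_eq_take.1
      (initial_prefix (pointFn b.2) (show m ≤ y.length by omega))
    rw [hby, length_initial] at h7
    rw [h6, hw, h7]
  have hab : b = a := Prod.ext (hbi.trans hai.symm) (hm b hb' a ha (by
    rw [hbm, ← hw, haw]))
  exact hbs z (inf_le_left.trans inf_le_right) (by omega) (hab ▸ hz)

/-- All points of one of the lists `E j` can be killed while the points in `B` and the points
in `A` with one label are kept alive, if there are more labels than points to be killed. -/
theorem exists_forall_dead (hM : M.AC00) (hBCP : M.BCP) {q : H} (hq : q ≠ ⊥)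
    (hfun : q ≤ M.isFun γ) (hred : ∀ β, q ⊓ M.imageMem Y γ β ≤ X β)
    (hX : ∀ β, X β ≤ ⨆ i, ⨆ _ : i ∈ I, ⨆ δ,
      ⨅ w, M.passes δ w ⇨ M.val β (pairJ i (seqCode w)) 0)
    (E : Fin k → List (ℕ × List ℕ))
    (hY : ∀ d : Fin k → ℕ × List ℕ, (∀ j, d j ∈ E j) → ∀ β, q ⊓ ⨅ j, alive β (d j) ≤ Y β)
    (A : Finset (ℕ × List ℕ)) (hBI : ∀ x ∈ B, x.1 ∉ I) (u : List ℕ)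
    (hA : ∀ x ∈ A, aliveAt u x) (hBu : ∀ x ∈ B, aliveAt u x)
    (hcard : ∑ j, (E j).length < (A.image lab).card) :
    ∃ q' ≤ q, q' ≠ ⊥ ∧ ∃ u', u <+: u' ∧ ∃ t ∈ A.image lab, ∃ j n₀,
      (∀ x ∈ A, lab x = t → aliveAt u' x) ∧ (∀ x ∈ B, aliveAt u' x) ∧
        ∀ x ∈ E j, dead γ n₀ q' u' x := by
  classical
  induction hn : ∑ j, (E j).length generalizing q u A E with
  | zero =>
    obtain ⟨t, ht⟩ := Finset.card_pos.1 (hn ▸ hcard)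
    by_cases hE : ∃ j, E j = []
    · obtain ⟨j, hj⟩ := hE
      exact ⟨q, le_rfl, hq, u, List.prefix_rfl, t, ht, j, 0, fun x hx _ => hA x hx, hBu, by
        simp [hj]⟩
    -- Total length `0` without an empty list leaves only `k = 0`, and there the index supplied by
    -- `exists_dead` is already absurd.
    · push Not at hE
      obtain ⟨q1, hq1, hb1, u1, hu1, t1, j, -⟩ := exists_dead (lab := lab) hM hBCP hq hfun hred hX
        (hY (fun j => (E j).head (hE j)) fun j => List.head_mem _) hBI hA hBu
      have := Finset.sum_eq_zero_iff.1 hn j (Finset.mem_univ j)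
      exact absurd (List.length_eq_zero_iff.1 this) (hE j)
  | succ n ih =>
    obtain ⟨t, ht⟩ := Finset.card_pos.1 ((Nat.zero_le _).trans_lt hcard)
    by_cases hE : ∃ j, E j = []
    · obtain ⟨j, hj⟩ := hE
      exact ⟨q, le_rfl, hq, u, List.prefix_rfl, t, ht, j, 0, fun x hx _ => hA x hx, hBu, by
        simp [hj]⟩
    · push Not at hE
      obtain ⟨q1, hq1, hb1, u1, hu1, t1, j, n1, hA1, hB1, hd1⟩ := exists_dead (lab := lab) hM hBCP
        hq hfun hred hX (hY (fun j => (E j).head (hE j)) fun j => List.head_mem _) hBI hA hBu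
      -- One point is dead and at most one label is spent, so the labels still outnumber the
      -- remaining points.
      set E' := Function.update E j (E j).tail with hE'
      have hsum : ∑ i, (E' i).length = n := by
        have h1 := Finset.add_sum_erase Finset.univ (fun i => (E i).length) (Finset.mem_univ j)
        have h2 := Finset.add_sum_erase Finset.univ (fun i => (E' i).length) (Finset.mem_univ j)
        have h3 : ∑ i ∈ Finset.univ.erase j, (E' i).length =
            ∑ i ∈ Finset.univ.erase j, (E i).length :=
          Finset.sum_congr rfl fun i hi => by
            rw [hE', Function.update_of_ne (Finset.ne_of_mem_erase hi)]
        have h4 : (E' j).length = (E j).length - 1 := by simp [hE']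
        have h5 := List.length_pos_iff.2 (hE j)
        omega
      have hsub : ∀ i, ∀ x ∈ E' i, x ∈ E i := by
        intro i x hx
        by_cases hi : i = j
        · subst hi
          rw [hE', Function.update_self] at hx
          exact List.mem_of_mem_tail hx
        · rwa [hE', Function.update_of_ne hi] at hx
      have himage : (A.image lab).erase t1 ⊆ (A.filter fun x => lab x ≠ t1).image lab := by
        intro t ht
        obtain ⟨h1, h2⟩ := Finset.mem_erase.1 ht
        obtain ⟨x, hx, rfl⟩ := Finset.mem_image.1 h2
        exact Finset.mem_image_of_mem _ (Finset.mem_filter.2 ⟨hx, h1⟩)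
      have hcard' : n < ((A.filter fun x => lab x ≠ t1).image lab).card := by
        have h1 := Finset.card_le_card himage
        have h2 := Finset.pred_card_le_card_erase (s := A.image lab) (a := t1)
        omega
      obtain ⟨q2, hq2, hb2, u2, hu2, t2, ht2, j2, n2, hA2, hB2, hd2⟩ := ih hb1 (hq1.trans hfun)
        (fun β => (inf_le_inf_right _ hq1).trans (hred β)) E'
        (fun d hd β => (inf_le_inf_right _ hq1).trans (hY d (fun i => hsub i _ (hd i)) β))
        (A.filter fun x => lab x ≠ t1) u1
        (fun x hx => hA1 x (Finset.mem_filter.1 hx).1 (Finset.mem_filter.1 hx).2) hB1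
        (hsum ▸ hcard') hsum
      obtain ⟨x2, hx2, rfl⟩ := Finset.mem_image.1 ht2
      obtain ⟨hx2A, hx2t⟩ := Finset.mem_filter.1 hx2
      refine ⟨q2, hq2.trans hq1, hb2, u2, hu1.trans hu2, lab x2, Finset.mem_image_of_mem _ hx2A,
        j2, max n1 n2, fun x hx hxt => hA2 x (Finset.mem_filter.2 ⟨hx, hxt ▸ hx2t⟩) hxt, hB2,
        fun x hx => ?_⟩
      by_cases hj : j2 = j
      · subst hj
        rw [← List.cons_head_tail (hE j2)] at hx
        rcases List.mem_cons.1 hx with rfl | hx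
        · exact dead_mono hd1 (le_max_left _ _) hq2 hu2
        · exact dead_mono (hd2 x (by rwa [hE', Function.update_self])) (le_max_right _ _) le_rfl
            List.prefix_rfl
      · exact dead_mono (hd2 x (by rwa [hE', Function.update_of_ne hj])) (le_max_right _ _) le_rfl
          List.prefix_rfl

end kill

/-! ### Descent in several steps -/

/-- A point counts as bad as soon as a bad point can be reached from it; a descent in several steps
then splits into single ones. -/
theorem HAcc_descent_transGen {S : Type*} {R : S → S → H} {bad : H → S → Prop}
    (h0 : ∀ q x, bad q x → q ≠ ⊥)
    (hmono : ∀ q q' x, bad q x → q' ≤ q → q' ≠ ⊥ → bad q' x)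
    (hstep : ∀ q x, bad q x → ∃ q' ≤ q, ∃ y, bad q' y ∧
      Relation.TransGen (fun a b => q' ≤ R a b) x y)
    {q : H} {x : S} (hx : bad q x) (hq : q ≤ HAcc R x) : False := by
  refine HAcc_descent
    (bad := fun q x => ∃ y, bad q y ∧ Relation.ReflTransGen (fun a b => q ≤ R a b) x y)
    (fun q x ⟨y, hy, _⟩ => h0 q y hy)
    (fun q q' x ⟨y, hy, hxy⟩ hqq hb => ⟨y, hmono q q' y hy hqq hb, ?_⟩)
    (fun q x ⟨y, hy, hxy⟩ => ?_) ⟨x, hx, .refl⟩ hq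
  · exact Relation.ReflTransGen.mono (fun a b hab => hqq.trans hab) _ _ hxy
  · obtain ⟨q', hq', z, hz, hyz⟩ := hstep q y hy
    have h1 : Relation.TransGen (fun a b => q' ≤ R a b) x z :=
      Relation.TransGen.trans_right (Relation.ReflTransGen.mono (fun a b hab => hq'.trans hab) _ _ hxy) hyz
    obtain ⟨w, hxw, hwz⟩ := Relation.TransGen.head'_iff.1 h1
    exact ⟨q', hq', w, ⟨z, hz, hwz⟩, hxw⟩

/-- The elements are replaced one after the other; `N ≠ 0` guarantees that at least one step is
made. -/
theorem transGen_multStep {S : Type*} {R : S → S → H} {q : H} {N : Multiset S} (hN : N ≠ 0)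
    (Y : S → Multiset S) (h : ∀ a ∈ N, ∀ y ∈ Y a, q ≤ R a y) (X : Multiset S) :
    Relation.TransGen (fun A B => q ≤ multStep R A B) (N + X) (N.bind Y + X) := by
  have step : ∀ a ∈ N, ∀ X, q ≤ multStep R (a ::ₘ X) (Y a + X) := fun a ha X =>
    le_multStep a X (Y a) (h a ha)
  have refl : ∀ N' ≤ N, ∀ X, Relation.ReflTransGen (fun A B => q ≤ multStep R A B) (N' + X)
      (N'.bind Y + X) := by
    intro N'
    induction N' using Multiset.induction_on with
    | empty => intro _ X; simpa using .refl
    | cons a N' ih =>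
      intro hN' X
      rw [Multiset.cons_bind, Multiset.cons_add, add_assoc, add_left_comm]
      refine .head (step a (Multiset.mem_of_le hN' (Multiset.mem_cons_self a N')) _) ?_
      rw [add_left_comm]
      exact ih ((Multiset.le_cons_self N' a).trans hN') (Y a + X)
  obtain ⟨a, ha⟩ := Multiset.exists_mem_of_ne_zero hN
  obtain ⟨N', rfl⟩ := Multiset.exists_cons_of_mem ha
  rw [Multiset.cons_bind, Multiset.cons_add, add_assoc, add_left_comm (Y a)]
  refine .head' (step a ha _) ?_
  rw [add_left_comm]
  exact refl N' (Multiset.le_cons_self N' a) (Y a + X)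

theorem HAcc_inf_valid_le (τ : M.Elem) (l : List ℕ) :
    HAcc (treeRel τ) [] ⊓ valid τ l ≤ HAcc (treeRel τ) l := by
  induction l using List.reverseRecOn with
  | nil => exact inf_le_left
  | append_singleton l c ih =>
    refine le_trans (le_inf ((inf_le_inf_left _ (valid_anti (List.prefix_append _ _))).trans ih) ?_)
      (HAcc_inf_le l (l ++ [c]))
    rw [treeRel_append]
    exact inf_le_right.trans valid_append_le

/-! ### Reductions -/

/-- Below `q`, `γ` reduces `X` to `Y`, and `Y` is built, by finite conjunctions of finite
disjunctions, from components in `Share Z`; the components with numbers in `J j` occur in the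
disjunction with number `j`. -/
structure IsReduction (q : H) (γ τ : M.Elem) (X Y : M.Elem → H) {k : ℕ} (J : Fin k → Finset ℕ) :
    Prop where
  isFun : q ≤ M.isFun γ
  image : ∀ β, q ⊓ X β ≤ M.imageMem Y γ β
  of_image : ∀ β, q ⊓ M.imageMem Y γ β ≤ X β
  target : ∀ d : Fin k → ℕ × List ℕ, (∀ j, (d j).1 ∈ J j) → ∀ β,
    ⨅ j, valid τ (d j).2 ⊓ alive β (d j) ≤ Y β
  of_target : ∀ j η n, Y η ≤ ⨆ i, ⨆ _ : i ∈ J j, ⨆ δ, ⨆ l,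
    (valid τ l ⊓ M.passes δ (initial (pointFn l) n)) ⊓
      ⨅ w, M.passes δ w ⇨ M.val η (pairJ i (seqCode w)) 0

/-- The coordinates at the node `s` with numbers `Nat.pair j p` lag behind the coordinates at the
node `(f j).2`, as long as a move is possible there. -/
def lags (σ : M.Elem) (q : H) {k : ℕ} (V : Finset (Fin k)) (s : List ℕ)
    (f : Fin k → ℕ × List ℕ) : Prop :=
  q ≤ legal σ s ∧ ∀ j ∈ V, q ⊓ canMove σ (f j).2 ≠ ⊥ → ∀ p < bound (f j).2,
    Nat.pair j p < bound s ∧ coord s (Nat.pair j p) <+: coord (f j).2 p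

/-- A state of the construction. The lists `L j`, for `j ∈ V`, contain nodes such that every
point of the components in `J j` that is not below one of them has been killed. -/
structure IsState (σ τ γ : M.Elem) {k : ℕ} (J : Fin k → Finset ℕ) (V : Finset (Fin k)) (i₀ : ℕ)
    (B : Finset (ℕ × List ℕ)) (q : H) (u : List ℕ) (n₀ : ℕ) (L : Fin k → List (ℕ × List ℕ)) :
    Prop where
  ne_bot : q ≠ ⊥
  aliveAt_B : ∀ x ∈ B, aliveAt u x
  source : ∃ s, q ≤ valid τ s ∧ aliveAt u (i₀, s)
  mem : ∀ j ∈ V, ∀ x ∈ L j, x.1 ∈ J j ∧ x.2 ≠ [] ∧ q ≤ valid τ x.2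
  cover : ∀ j ∈ V, ∀ i ∈ J j, ∀ l, q ⊓ valid τ l ≠ ⊥ →
    (∃ x ∈ L j, x.1 = i ∧ x.2 <+: l) ∨ dead γ n₀ q u (i, l)
  chase : ∀ f : Fin k → ℕ × List ℕ, (∀ j ∈ V, f j ∈ L j) → ∃ s a, aliveAt u (i₀, s) ∧
    q ≤ valid τ s ∧ q ≤ canMove σ s ∧ ∀ t, lags σ q V (s ++ [Nat.pair a t]) f

section

variable {σ τ γ : M.Elem} {X Y : M.Elem → H} {k : ℕ} {J : Fin k → Finset ℕ} {q₀ : H}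
  {V : Finset (Fin k)} {i₀ : ℕ} {B : Finset (ℕ × List ℕ)}

theorem lags.mono {q q' : H} {s : List ℕ} {f : Fin k → ℕ × List ℕ} (h : lags σ q V s f)
    (hq : q' ≤ q) : lags σ q' V s f :=
  ⟨hq.trans h.1, fun j hj hne => h.2 j hj (ne_bot_of_le (inf_le_inf_right _ hq) hne)⟩

theorem IsState.mono {q q' : H} {u : List ℕ} {n₀ : ℕ} {L : Fin k → List (ℕ × List ℕ)}
    (h : IsState σ τ γ J V i₀ B q u n₀ L) (hq : q' ≤ q) (hb : q' ≠ ⊥) :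
    IsState σ τ γ J V i₀ B q' u n₀ L where
  ne_bot := hb
  aliveAt_B := h.aliveAt_B
  source := h.source.imp fun s hs => ⟨hq.trans hs.1, hs.2⟩
  mem j hj x hx := ⟨(h.mem j hj x hx).1, (h.mem j hj x hx).2.1, hq.trans (h.mem j hj x hx).2.2⟩
  cover j hj i hi l hl := (h.cover j hj i hi l (ne_bot_of_le (inf_le_inf_right _ hq) hl)).imp_right
    fun hd => dead_mono hd le_rfl hq List.prefix_rfl
  chase f hf := by
    obtain ⟨s, a, h1, h2, h3, h4⟩ := h.chase f hf
    exact ⟨s, a, h1, hq.trans h2, hq.trans h3, fun t => (h4 t).mono hq⟩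

/-- It is not possible to kill all points of the components in `J j`. -/
theorem IsState.ne_nil (hM : M.AC00) (hred : IsReduction q₀ γ τ X Y J)
    (hsrc : ∀ s β, q₀ ⊓ valid τ s ⊓ alive β (i₀, s) ⊓ (⨅ x ∈ B, alive β x) ≤ X β)
    {q : H} {u : List ℕ} {n₀ : ℕ} {L : Fin k → List (ℕ × List ℕ)} (hq : q ≤ q₀)
    (h : IsState σ τ γ J V i₀ B q u n₀ L) {j : Fin k} (hj : j ∈ V) : L j ≠ [] := by
  intro hL
  obtain ⟨s, hs, hsu⟩ := h.source
  -- Take `u` followed by zeros. Nothing more is excluded, so the source point survives and `β` is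
  -- in `X`. Its image then admits, up to length `n₀`, a point of a component in `J j`, but with `L
  -- j` empty all these points are dead by length `n₀`.
  obtain ⟨β, hβ⟩ := exists_inf_ne_bot h.ne_bot
    (le_top.trans (iSup_isStd hM fun i => u.getD i 0).ge)
  set q1 := q ⊓ isStd β fun i => u.getD i 0
  have h1 : q1 ≤ q := inf_le_left
  have halive : ∀ x, aliveAt u x → q1 ≤ alive β x := fun x hx => le_iInf fun n => by
    have := isStd_le_val β (fun i => u.getD i 0) (place x n)
    rw [hx n] at this
    exact inf_le_right.trans this
  have hu : q1 ≤ M.passes β u := by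
    have := isStd_le_passes β (fun i => u.getD i 0) u.length
    rw [initial_getD] at this
    exact inf_le_right.trans this
  have hX : q1 ≤ X β := by
    refine le_trans ?_ (hsrc s β)
    exact le_inf (le_inf (le_inf (h1.trans hq) (h1.trans hs)) (halive _ hsu))
      (le_iInf₂ fun x hx => halive x (h.aliveAt_B x hx))
  refine hβ (le_bot_iff.1 ?_)
  refine iSup_elim ((le_inf (h1.trans hq) hX).trans (hred.image β)) fun η q2 hq2 hη => ?_
  refine iSup_elim ((hη.trans inf_le_right).trans (hred.of_target j η n₀)) fun i q3 hq3 h3 => ?_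
  refine iSup_elim h3 fun hi q4 hq4 h4 => ?_
  refine iSup_elim h4 fun δ q5 hq5 h5 => ?_
  refine iSup_elim h5 fun l q6 hq6 h6 => ?_
  by_cases hb : q6 = ⊥
  · exact hb.le
  have h62 : q6 ≤ q2 := hq6.trans (hq5.trans (hq4.trans hq3))
  have h61 : q6 ≤ q1 := h62.trans hq2
  have hv : q ⊓ valid τ l ≠ ⊥ :=
    ne_bot_of_le (le_inf (h61.trans h1) (h6.trans (inf_le_left.trans inf_le_left))) hb
  rcases h.cover j hj i hi l hv with ⟨x, hx, -⟩ | ⟨n, hn, y, hd⟩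
  · simp [hL] at hx
  · have hval : q6 ≤ M.isValue γ β (place (i, l) n) (y + 1) :=
      (le_inf (h61.trans h1) (h61.trans hu)).trans (hd β)
    have hη0 : q6 ≤ M.val η (place (i, l) n) 0 :=
      himp_elim (h6.trans (inf_le_right.trans (iInf_le _ (initial (pointFn l) n))))
        (h6.trans (inf_le_left.trans (inf_le_right.trans (passes_anti (initial_prefix _ hn)))))
    refine iSup_elim (h62.trans (hη.trans (inf_le_left.trans (iInf_le _ (place (i, l) n)))))
      fun p q7 hq7 h7 => ?_
    by_cases hp : p = y + 1
    · subst hp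
      rw [← M.val_unique η (place (i, l) n) 0 (y + 1) (by omega)]
      exact le_inf (hq7.trans hη0) (h7.trans inf_le_right)
    · rw [← isValue_inf_isValue hp]
      exact le_inf (h7.trans inf_le_left) (hq7.trans hval)

end

/-! ### Following a move of the target, and replacing dead nodes by their children. -/

section

variable {σ τ γ : M.Elem} {X Y : M.Elem → H} {k : ℕ} {J : Fin k → Finset ℕ} {q₀ : H}
  {V : Finset (Fin k)} {i₀ : ℕ} {B : Finset (ℕ × List ℕ)}

/-- If a node `s` lags behind nodes one of which makes a move, then `s` can be moved such that it
still lags behind. -/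
theorem lags.exists_move {q : H} (hq : q ≠ ⊥) {j : Fin k} (hj : j ∈ V) {x : ℕ × List ℕ}
    (hx : x.2 ≠ []) {s : List ℕ} (hs : s ≠ []) {f : Fin k → ℕ × List ℕ}
    (h : lags σ q V s (Function.update f j x)) (hmove : q ≤ canMove σ x.2)
    (hdec : ∀ p < bound x.2,
      q ≤ innerNode σ (coord x.2 p) ∨ q ⊓ innerNode σ (coord x.2 p) = ⊥) (c : ℕ) :
    q ≤ canMove σ s ∧ ∃ a, ∀ t, lags σ q V (s ++ [Nat.pair a t])
      (Function.update f j (x.1, x.2 ++ [c])) := by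
  have hlag : ∀ p < bound x.2,
      Nat.pair j p < bound s ∧ coord s (Nat.pair j p) <+: coord x.2 p := by
    have := h.2 j hj
    rw [Function.update_self, inf_eq_left.2 hmove] at this
    exact this hq
  -- If the child can still move, `c` was a legal move and `s` follows in the same coordinate. As
  -- `s` may be far behind, with remainder `r`, its direction is the first entry of `r ++ [moveDir
  -- c]`. If the child cannot move, nothing has to be preserved for `j` and any movable coordinate
  -- will do.
  obtain ⟨p₀, hp₀, hin, e, he⟩ : ∃ p₀ < bound x.2, q ≤ innerNode σ (coord x.2 p₀) ∧ ∃ e,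
      q ⊓ canMove σ (x.2 ++ [c]) ≠ ⊥ → ∀ p < bound x.2,
        coord s (Nat.pair j p) ++ (if p₀ = p then [e] else []) <+: coord (x.2 ++ [c]) p := by
    by_cases hz : q ⊓ canMove σ (x.2 ++ [c]) = ⊥
    · obtain ⟨p, hp⟩ := exists_inf_ne_bot hq (hmove.trans (canMove_le_innerNode hx))
      exact ⟨p, p.2, (hdec p p.2).resolve_right hp, 0, fun h => absurd hz h⟩
    · have h1 : q ⊓ canMove σ (x.2 ++ [c]) ≤ moveOK σ x.2 c := by
        refine inf_le_right.trans ((canMove_le_legal (by simp)).trans ?_)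
        rw [legal_append]
        exact inf_le_right
      obtain ⟨h2, h3⟩ := moveOK_elim hz hx h1
      have h4 := (hdec _ h2).resolve_right
        (ne_bot_of_le (le_inf inf_le_left h3) hz)
      obtain ⟨r, hr⟩ := (hlag _ h2).2
      refine ⟨moveCoord c, h2, h4, (r ++ [moveDir c]).headD 0, fun _ p hp => ?_⟩
      rw [coord_append hx]
      by_cases hpc : moveCoord c = p
      · subst hpc
        rw [if_pos rfl, if_pos rfl, ← hr, List.append_assoc, List.prefix_append_right_inj]
        cases r <;> simp
      · rw [if_neg hpc, if_neg hpc, List.append_nil, List.append_nil]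
        exact (hlag p hp).2
  have hin' : q ≤ innerNode σ (coord s (Nat.pair j p₀)) :=
    hin.trans (innerNode_anti (hlag p₀ hp₀).2)
  refine ⟨le_canMove h.1 (hlag p₀ hp₀).1 hin', Nat.pair (Nat.pair j p₀) e, fun t => ?_⟩
  have hc : moveCoord (Nat.pair (Nat.pair (Nat.pair j p₀) e) t) = Nat.pair j p₀ := by
    simp [moveCoord]
  have hd : moveDir (Nat.pair (Nat.pair (Nat.pair j p₀) e) t) = e := by simp [moveDir]
  refine ⟨?_, fun j' hj' hne p hp => ?_⟩
  · rw [legal_append]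
    refine le_inf h.1 (le_moveOK ?_ ?_)
    · rw [hc]; exact (hlag p₀ hp₀).1
    · rw [hc]; exact hin'
  · rw [bound_append hs, coord_append hs, hc, hd]
    by_cases hjj : j' = j
    · subst hjj
      rw [Function.update_self] at hne hp ⊢
      simp only [bound_append hx] at hp
      refine ⟨(hlag p hp).1, ?_⟩
      simpa only [Nat.pair_eq_pair, true_and] using he hne p hp
    · have h5 := h.2 j' hj'
      rw [Function.update_of_ne hjj] at hne hp ⊢ h5
      rw [if_neg (fun h6 => hjj (Fin.ext (Nat.pair_eq_pair.1 h6).1.symm)), List.append_nil]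
      exact h5 hne p hp

open Classical in
/-- The nodes that may follow the node `x.2`. -/
noncomputable def children (σ : M.Elem) (q : H) (n : ℕ) (x : ℕ × List ℕ) : List (ℕ × List ℕ) :=
  if q ≤ canMove σ x.2 then (List.range n).map fun c => (x.1, x.2 ++ [c]) else []

theorem mem_children {q : H} {n : ℕ} {x y : ℕ × List ℕ} : y ∈ children σ q n x ↔
    q ≤ canMove σ x.2 ∧ ∃ c < n, y = (x.1, x.2 ++ [c]) := by
  unfold children
  split_ifs with h
  · simp [h, eq_comm]
  · simp [h]

/-- If all points in a list are dead, then they can be replaced by their children. -/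
theorem IsState.replace {q q' : H} {u u' : List ℕ} {n₀ n₁ : ℕ}
    {L : Fin k → List (ℕ × List ℕ)} (hτ : q ≤ isSumStump σ τ)
    (h : IsState σ τ γ J V i₀ B q u n₀ L) {j : Fin k} (hj : j ∈ V) (hL : ∀ j ∈ V, L j ≠ [])
    (hq : q' ≤ q) (hb : q' ≠ ⊥) (hu : u <+: u') (hn : n₀ ≤ n₁)
    (hB : ∀ x ∈ B, aliveAt u' x) (hdead : ∀ x ∈ L j, dead γ n₁ q' u' x)
    (hdec : ∀ x ∈ L j, q' ≤ canMove σ x.2 ∨ q' ⊓ canMove σ x.2 = ⊥)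
    (hdec' : ∀ x ∈ L j, ∀ p < bound x.2,
      q' ≤ innerNode σ (coord x.2 p) ∨ q' ⊓ innerNode σ (coord x.2 p) = ⊥)
    (hsrc : ∀ f : Fin k → ℕ × List ℕ, (∀ j ∈ V, f j ∈ L j) → ∃ s, s ≠ [] ∧ aliveAt u' (i₀, s) ∧
      q' ≤ valid τ s ∧ lags σ q' V s f) :
    IsState σ τ γ J V i₀ B q' u' n₁
      (Function.update L j ((L j).flatMap (children σ q' n₁))) where
  ne_bot := hb
  aliveAt_B := hB
  source := by
    have : ∀ j, ∃ x, j ∈ V → x ∈ L j := fun j => by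
      by_cases hj : j ∈ V
      · exact ⟨_, fun _ => List.head_mem (hL j hj)⟩
      · exact ⟨(0, []), fun h => absurd h hj⟩
    choose f hf using this
    obtain ⟨s, -, h1, h2, -⟩ := hsrc f hf
    exact ⟨s, h2, h1⟩
  mem j' hj' x hx := by
    by_cases hjj : j' = j
    · subst hjj
      rw [Function.update_self, List.mem_flatMap] at hx
      obtain ⟨y, hy, hx⟩ := hx
      obtain ⟨hm, c, -, rfl⟩ := mem_children.1 hx
      obtain ⟨h1, h2, h3⟩ := h.mem j' hj y hy
      exact ⟨h1, by simp, le_valid_append (hq.trans h3) (val_of_canMove (hq.trans hτ) hm)⟩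
    · rw [Function.update_of_ne hjj] at hx
      obtain ⟨h1, h2, h3⟩ := h.mem j' hj' x hx
      exact ⟨h1, h2, hq.trans h3⟩
  cover j' hj' i hi l hl := by
    rcases h.cover j' hj' i hi l (ne_bot_of_le (inf_le_inf_right _ hq) hl) with
      ⟨x, hx, rfl, r, rfl⟩ | hd
    · by_cases hjj : j' = j
      · subst hjj
        cases r with
        | nil =>
          right
          rw [List.append_nil]
          exact hdead x hx
        | cons c r =>
          have hm : q' ≤ canMove σ x.2 := by
            refine (hdec x hx).resolve_right (ne_bot_of_le (le_inf inf_le_left ?_) hl)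
            exact canMove_of_val (inf_le_left.trans (hq.trans hτ))
              (inf_le_right.trans valid_append_le)
          by_cases hc : c < n₁
          · left
            refine ⟨(x.1, x.2 ++ [c]), ?_, rfl, r, by simp⟩
            rw [Function.update_self, List.mem_flatMap]
            exact ⟨x, hx, mem_children.2 ⟨hm, c, hc, rfl⟩⟩
          -- The number of this child is at least `n₁`, so it shares with `x` the initial part whose
          -- exclusion killed `x`.
          · right
            obtain ⟨n, hn', y, hy⟩ := hdead x hx
            exact ⟨n, hn', y, by rwa [place_append _ _ _ (by omega : n ≤ c)]⟩
      · left
        exact ⟨x, by rwa [Function.update_of_ne hjj], rfl, r, rfl⟩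
    · exact .inr (dead_mono hd hn hq hu)
  chase f hf := by
    have h1 := hf j hj
    rw [Function.update_self, List.mem_flatMap] at h1
    obtain ⟨x, hx, hfx⟩ := h1
    obtain ⟨hm, c, -, hfx⟩ := mem_children.1 hfx
    -- With the parent `x` in place of the child `f j`, a surviving source node that lags behind is
    -- already known; it has a further move in reserve.
    obtain ⟨s, hs, h1, h2, h3⟩ := hsrc (Function.update f j x) fun j' hj' => by
      by_cases hjj : j' = j
      · subst hjj
        rwa [Function.update_self]
      · have := hf j' hj'
        rw [Function.update_of_ne hjj] at this ⊢
        exact this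
    obtain ⟨h4, a, h5⟩ := h3.exists_move hb hj (h.mem j hj x hx).2.1 hs hm (hdec' x hx) c
    refine ⟨s, a, h1, h2, h4, ?_⟩
    rwa [← hfx, Function.update_eq_self] at h5

/-- The nodes of a state, as a multiset. -/
def nodes (V : Finset (Fin k)) (L : Fin k → List (ℕ × List ℕ)) : Multiset (List ℕ) :=
  ∑ j ∈ V, (((L j).map Prod.snd : List (List ℕ)) : Multiset (List ℕ))

theorem transGen_nodes {q : H} (hτ : q ≤ isSumStump σ τ) {L : Fin k → List (ℕ × List ℕ)}
    {j : Fin k} (hj : j ∈ V) (hL : L j ≠ []) (n : ℕ) :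
    Relation.TransGen (fun a b => q ≤ multStep (treeRel τ) a b) (nodes V L)
      (nodes V (Function.update L j ((L j).flatMap (children σ q n)))) := by
  classical
  set Y : List ℕ → Multiset (List ℕ) := fun a =>
    (((children σ q n (0, a)).map Prod.snd : List (List ℕ)) : Multiset (List ℕ)) with hY
  have hmap : ∀ x, (children σ q n x).map Prod.snd = (children σ q n (0, x.2)).map Prod.snd := by
    intro x
    unfold children
    split_ifs <;> simp [Function.comp_def]
  have hbind : (((L j).map Prod.snd : List (List ℕ)) : Multiset (List ℕ)).bind Y =
      ((((L j).flatMap (children σ q n)).map Prod.snd : List (List ℕ)) : Multiset (List ℕ)) := by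
    simp only [hY, Multiset.coe_bind, List.map_flatMap, List.flatMap_map, ← hmap]
  have hrest : ∑ i ∈ V.erase j, (((Function.update L j ((L j).flatMap (children σ q n)) i).map
      Prod.snd : List (List ℕ)) : Multiset (List ℕ)) =
      ∑ i ∈ V.erase j, (((L i).map Prod.snd : List (List ℕ)) : Multiset (List ℕ)) :=
    Finset.sum_congr rfl fun i hi => by rw [Function.update_of_ne (Finset.ne_of_mem_erase hi)]
  rw [nodes, nodes, ← Finset.add_sum_erase V _ hj, ← Finset.add_sum_erase V _ hj, hrest,
    Function.update_self, ← hbind]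
  refine transGen_multStep (by simpa using hL) Y (fun a _ y hy => ?_) _
  obtain ⟨z, hz, rfl⟩ := List.mem_map.1 (Multiset.mem_coe.1 hy)
  obtain ⟨hm, c, -, rfl⟩ := mem_children.1 hz
  rw [treeRel_append]
  exact val_of_canMove hτ hm

end

/-! ### The chase, and the forced kill of a new root. -/

section

variable {σ τ γ : M.Elem} {X Y : M.Elem → H} {k : ℕ} {J : Fin k → Finset ℕ} {q₀ : H}
  {V : Finset (Fin k)} {I : Set ℕ} {i₀ : ℕ} {B : Finset (ℕ × List ℕ)} {cU : Fin k → ℕ}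

/-- A point of one of the components `cU j` with `j ∉ V` is killed, while the points in `B` and
some point of the component with number `i₀` are kept alive. -/
def NewKill (γ τ : M.Elem) {k : ℕ} (V : Finset (Fin k)) (i₀ : ℕ) (B : Finset (ℕ × List ℕ))
    (cU : Fin k → ℕ) (q : H) (u : List ℕ) : Prop :=
  ∃ q' ≤ q, q' ≠ ⊥ ∧ ∃ u', u <+: u' ∧ (∀ x ∈ B, aliveAt u' x) ∧
    (∃ s, q' ≤ valid τ s ∧ aliveAt u' (i₀, s)) ∧ ∃ j ∉ V, ∃ n, dead γ n q' u' (cU j, [])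

/-- Either one of the other components is touched, or the nodes of one of the lists can be
replaced by their children. -/
theorem IsState.step (hM : M.AC00) (hBCP : M.BCP) (hτ : q₀ ≤ isSumStump σ τ)
    (hred : IsReduction q₀ γ τ X Y J)
    (hX : ∀ β, X β ≤ ⨆ i, ⨆ _ : i ∈ I, ⨆ δ,
      ⨅ w, M.passes δ w ⇨ M.val β (pairJ i (seqCode w)) 0)
    (hBI : ∀ x ∈ B, x.1 ∉ I) (hcU : ∀ j ∉ V, cU j ∈ J j) {q : H} {u : List ℕ} {n₀ : ℕ}
    {L : Fin k → List (ℕ × List ℕ)} (hq : q ≤ q₀) (h : IsState σ τ γ J V i₀ B q u n₀ L)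
    (hL : ∀ j ∈ V, L j ≠ []) :
    NewKill γ τ V i₀ B cU q u ∨ ∃ q' ≤ q, ∃ u', u <+: u' ∧ ∃ n, ∃ j ∈ V,
      IsState σ τ γ J V i₀ B q' u' n
        (Function.update L j ((L j).flatMap (children σ q' n))) := by
  classical
  have hex : ∀ f : Fin k → ℕ × List ℕ, ∃ s a, (∀ j ∈ V, f j ∈ L j) → aliveAt u (i₀, s) ∧
      q ≤ valid τ s ∧ q ≤ canMove σ s ∧ ∀ t, lags σ q V (s ++ [Nat.pair a t]) f := by
    intro f
    by_cases hf : ∀ j ∈ V, f j ∈ L j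
    · obtain ⟨s, a, hs⟩ := h.chase f hf
      exact ⟨s, a, fun _ => hs⟩
    · exact ⟨[], 0, fun h => absurd h hf⟩
  choose s a hsa using hex
  -- A conjunct outside `V` is represented by one root only. If its list is the one that dies,
  -- `NewKill` has been achieved.
  set E : Fin k → List (ℕ × List ℕ) := fun j => if j ∈ V then L j else [(cU j, [])] with hE
  have hEV : ∀ j ∈ V, E j = L j := fun j hj => if_pos hj
  have hEU : ∀ j ∉ V, E j = [(cU j, [])] := fun j hj => if_neg hj
  have hEne : ∀ j, E j ≠ [] := by
    intro j
    by_cases hj : j ∈ V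
    · rw [hEV j hj]; exact hL j hj
    · rw [hEU j hj]; simp
  set N := ∑ j, (E j).length
  set P := Fintype.piFinset fun j => (E j).toFinset
  have hP : ∀ {f}, f ∈ P ↔ ∀ j, f j ∈ E j := by simp [P]
  -- There are `N` points to be killed, so `N + 1` labels are provided. They start at `u.length` in
  -- order that `aliveAt_append` applies.
  set T := Finset.Ico u.length (u.length + (N + 1))
  -- The same labels are used for all selections `f`, so the one label that survives keeps a
  -- suitable source node alive for every selection simultaneously.
  set p : (Fin k → ℕ × List ℕ) × ℕ → ℕ × List ℕ := fun z =>
    (i₀, s z.1 ++ [Nat.pair (a z.1) z.2])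
  set lab : ℕ × List ℕ → ℕ := fun x => (x.2.getLastD 0).unpair.2
  have hlab : ∀ f t, lab (p (f, t)) = t := by simp [lab, p]
  set f₀ : Fin k → ℕ × List ℕ := fun j => (E j).head (hEne j)
  have hf₀ : f₀ ∈ P := hP.2 fun j => List.head_mem _
  have himg : ((P ×ˢ T).image p).image lab = T := by
    ext t
    simp only [Finset.mem_image, Finset.mem_product]
    constructor
    · rintro ⟨x, ⟨⟨f, t'⟩, ⟨-, ht⟩, rfl⟩, rfl⟩
      rwa [hlab]
    · exact fun ht => ⟨p (f₀, t), ⟨(f₀, t), ⟨hf₀, ht⟩, rfl⟩, hlab _ _⟩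
  obtain ⟨q1, hq1, hb1, u1, hu1, t, ht, j, n, hA, hB, hd⟩ := exists_forall_dead (lab := lab)
    (I := I) hM hBCP h.ne_bot (hq.trans hred.isFun)
    (fun β => (inf_le_inf_right _ hq).trans (hred.of_image β)) hX E
    (fun d hd β => by
      have hmem : ∀ j, (d j).1 ∈ J j ∧ q ≤ valid τ (d j).2 := by
        intro j
        have := hd j
        by_cases hj : j ∈ V
        · rw [hEV j hj] at this
          exact ⟨(h.mem j hj _ this).1, (h.mem j hj _ this).2.2⟩
        · rw [hEU j hj, List.mem_singleton] at this
          rw [this]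
          exact ⟨hcU j hj, by rw [valid_nil]; exact le_top⟩
      refine le_trans (le_iInf fun j => ?_) (hred.target d (fun j => (hmem j).1) β)
      exact inf_le_inf (hmem j).2 (iInf_le _ j))
    ((P ×ˢ T).image p) hBI u
    (fun x hx => by
      obtain ⟨⟨f, t⟩, hft, rfl⟩ := Finset.mem_image.1 hx
      obtain ⟨hf, ht⟩ := Finset.mem_product.1 hft
      have hf' : ∀ j ∈ V, f j ∈ L j := fun j hj => hEV j hj ▸ hP.1 hf j
      exact aliveAt_append (hsa f hf').1
        ((Finset.mem_Ico.1 ht).1.trans (Nat.right_le_pair _ _)))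
    h.aliveAt_B (by rw [himg]; simp [T, N])
  rw [himg] at ht
  have hsrc : ∀ f : Fin k → ℕ × List ℕ, (∀ j ∈ V, f j ∈ L j) → ∃ s, s ≠ [] ∧
      aliveAt u1 (i₀, s) ∧ q ≤ valid τ s ∧ lags σ q V s f := by
    intro f hf
    set f₁ : Fin k → ℕ × List ℕ := fun j => if j ∈ V then f j else (E j).head (hEne j) with hf₁
    have hfV : ∀ j ∈ V, f₁ j = f j := fun j hj => if_pos hj
    have hf₁P : f₁ ∈ P := hP.2 fun j => by
      by_cases hj : j ∈ V
      · rw [hfV j hj, hEV j hj]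
        exact hf j hj
      · simp only [hf₁, if_neg hj]
        exact List.head_mem _
    obtain ⟨-, h2, h3, h4⟩ := hsa f₁ fun j hj => hfV j hj ▸ hf j hj
    refine ⟨s f₁ ++ [Nat.pair (a f₁) t], by simp, ?_, ?_, (h4 t).1, fun j hj => ?_⟩
    · exact hA (p (f₁, t)) (Finset.mem_image_of_mem p (Finset.mem_product.2 ⟨hf₁P, ht⟩))
        (hlab _ _)
    · exact le_valid_append h2 (val_of_canMove (hq.trans hτ) h3)
    · have := (h4 t).2 j hj
      rwa [hfV j hj] at this
  by_cases hj : j ∈ V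
  · right
    obtain ⟨q2, hq2, hb2, hd2⟩ := exists_decides (L j).toFinset (fun x => canMove σ x.2)
      (fun x _ => isComplemented_canMove σ x.2) hb1
    obtain ⟨q3, hq3, hb3, hd3⟩ := exists_decides
      ((L j).toFinset.biUnion fun x => (Finset.range (bound x.2)).image (coord x.2))
      (fun l => innerNode σ l) (fun l _ => isComplemented_valid σ (l ++ [0])) hb2
    have hq31 : q3 ≤ q1 := hq3.trans hq2
    refine ⟨q3, hq31.trans hq1, u1, hu1, max n₀ n, j, hj, h.replace (hq.trans hτ) hj hL
      (hq31.trans hq1) hb3 hu1 (le_max_left _ _) hB (fun x hx => ?_) (fun x hx => ?_)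
      (fun x hx p hp => ?_) fun f hf => ?_⟩
    · exact dead_mono (hd x (by rwa [hEV j hj])) (le_max_right _ _) hq31 List.prefix_rfl
    · exact (hd2 x (List.mem_toFinset.2 hx)).imp hq3.trans
        fun h => le_bot_iff.1 ((inf_le_inf_right _ hq3).trans h.le)
    · refine hd3 _ (Finset.mem_biUnion.2 ⟨x, List.mem_toFinset.2 hx, ?_⟩)
      exact Finset.mem_image_of_mem _ (Finset.mem_range.2 hp)
    · obtain ⟨s, h1, h2, h3, h4⟩ := hsrc f hf
      exact ⟨s, h1, h2, (hq31.trans hq1).trans h3, h4.mono (hq31.trans hq1)⟩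
  · left
    obtain ⟨s, -, h1, h2, -⟩ := hsrc f₀ fun j hj => hEV j hj ▸ hP.1 hf₀ j
    refine ⟨q1, hq1, hb1, u1, hu1, hB, ⟨_, hq1.trans h2, h1⟩, j, hj, n, hd _ ?_⟩
    rw [hEU j hj]
    exact List.mem_singleton_self _

/-- If all points of the components in `J j`, for `j ∈ V`, with root `[]` have been killed, then
a point of one of the other components in `Y` can be killed. -/
theorem IsReduction.newKill (hM : M.AC00) (hBCP : M.BCP) (hτ : q₀ ≤ isSumStump σ τ)
    (hacc : q₀ ≤ HAcc (treeRel τ) []) (hred : IsReduction q₀ γ τ X Y J)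
    (hX : ∀ β, X β ≤ ⨆ i, ⨆ _ : i ∈ I, ⨆ δ,
      ⨅ w, M.passes δ w ⇨ M.val β (pairJ i (seqCode w)) 0)
    (hsrc : ∀ s β, q₀ ⊓ valid τ s ⊓ alive β (i₀, s) ⊓ (⨅ x ∈ B, alive β x) ≤ X β)
    (hBI : ∀ x ∈ B, x.1 ∉ I) (hcU : ∀ j ∉ V, cU j ∈ J j) (hq : q₀ ≠ ⊥) {u : List ℕ} {n₀ : ℕ}
    (hdead : ∀ j ∈ V, ∀ i ∈ J j, dead γ n₀ q₀ u (i, [])) (hB : ∀ x ∈ B, aliveAt u x)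
    (hu : aliveAt u (i₀, [])) : NewKill γ τ V i₀ B cU q₀ u := by
  by_contra hno
  -- The children with numbers from `n₀` on have died together with the roots.
  set L : Fin k → List (ℕ × List ℕ) := fun j =>
    (J j ×ˢ Finset.range n₀).toList.map fun z => (z.1, [z.2])
  have hL : ∀ {j x}, x ∈ L j ↔ ∃ i ∈ J j, ∃ c < n₀, x = (i, [c]) := by
    intro j x
    simp only [L, List.mem_map, Finset.mem_toList, Finset.mem_product, Finset.mem_range,
      Prod.exists]
    constructor
    · rintro ⟨i, c, ⟨h1, h2⟩, rfl⟩
      exact ⟨i, h1, c, h2, rfl⟩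
    · rintro ⟨i, h1, c, h2, rfl⟩
      exact ⟨i, c, ⟨h1, h2⟩, rfl⟩
  have hroot : q₀ ≤ M.val τ (seqCode []) 0 :=
    val_of_canMove hτ (by rw [canMove_nil]; exact le_top)
  have hinit : IsState σ τ γ J V i₀ B q₀ u n₀ L := by
    refine ⟨hq, hB, ⟨[], by rw [valid_nil]; exact le_top, hu⟩, fun j hj x hx => ?_,
      fun j hj i hi l hl => ?_, fun f hf => ?_⟩
    · obtain ⟨i, hi, c, -, rfl⟩ := hL.1 hx
      exact ⟨hi, by simp, le_valid_append (l := []) (by rw [valid_nil]; exact le_top) hroot⟩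
    · cases l with
      | nil => exact .inr (hdead j hj i hi)
      | cons c l =>
        by_cases hc : c < n₀
        · exact .inl ⟨(i, [c]), hL.2 ⟨i, hi, c, hc, rfl⟩, rfl, l, rfl⟩
        · obtain ⟨n, hn, y, hy⟩ := hdead j hj i hi
          refine .inr ⟨n, hn, y, ?_⟩
          rwa [← List.nil_append (c :: l), place_append _ _ _ (by omega : n ≤ c)]
    -- Here closure under natural sums is used: the first move of the source chooses so many
    -- coordinates that every coordinate `p` of every selected node `f j` has a counterpart with
    -- number `Nat.pair j p`.
    · refine ⟨[], ∑ j : Fin k, ∑ p ∈ Finset.range (bound (f j).2), (Nat.pair j p + 1), hu,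
        by rw [valid_nil]; exact le_top, by rw [canMove_nil]; exact le_top, fun t => ?_⟩
      refine ⟨by rw [List.nil_append, legal_singleton]; exact le_top, fun j _ _ p hp => ⟨?_, ?_⟩⟩
      · have h1 := Finset.single_le_sum (f := fun p => Nat.pair j p + 1) (fun _ _ => Nat.zero_le _)
          (Finset.mem_range.2 hp)
        have h2 := Finset.single_le_sum
          (f := fun j : Fin k => ∑ p ∈ Finset.range (bound (f j).2), (Nat.pair j p + 1))
          (fun _ _ => Nat.zero_le _) (Finset.mem_univ j)
        simp only [bound, List.nil_append, List.headD_cons, Nat.unpair_pair] at h1 h2 ⊢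
        omega
      · rw [List.nil_append, coord_singleton]
        exact List.nil_prefix
  -- Without a new kill every state leads to another one whose nodes are strictly lower in the
  -- multiset order.
  refine HAcc_descent_transGen (R := multStep (treeRel τ)) (bad := fun q N => q ≤ q₀ ∧
    ∃ u' n L, u <+: u' ∧ IsState σ τ γ J V i₀ B q u' n L ∧ nodes V L = N) ?_ ?_ ?_
    ⟨le_rfl, u, n₀, L, List.prefix_rfl, hinit, rfl⟩ (le_HAcc_multStep _ fun l hl => ?_)
  · rintro q N ⟨-, u', n, L, -, h, -⟩
    exact h.ne_bot
  · rintro q q' N ⟨hq, u', n, L, hu, h, hN⟩ hqq hb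
    exact ⟨hqq.trans hq, u', n, L, hu, h.mono hqq hb, hN⟩
  · rintro q N ⟨hq, u', n, L, hu', h, rfl⟩
    have hne : ∀ j ∈ V, L j ≠ [] := fun j hj => h.ne_nil hM hred hsrc hq hj
    rcases h.step hM hBCP hτ hred hX hBI hcU hq hne with
      ⟨q', hq', hb, u'', hu'', hrest⟩ | ⟨q', hq', u'', hu'', n', j, hj, h'⟩
    · exact absurd ⟨q', hq'.trans hq, hb, u'', hu'.trans hu'', hrest⟩ hno
    · exact ⟨q', hq', _, ⟨hq'.trans hq, u'', n', _, hu'.trans hu'', h', rfl⟩,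
        transGen_nodes (hq'.trans (hq.trans hτ)) hj (hne j hj) n'⟩
  · obtain ⟨j, hj, hl⟩ := Multiset.mem_sum.1 hl
    obtain ⟨x, hx, rfl⟩ := List.mem_map.1 (Multiset.mem_coe.1 hl)
    exact (le_inf hacc (hinit.mem j hj x hx).2.2).trans (HAcc_inf_valid_le τ x.2)

end

/-! ### Productivity -/

section

variable {σ τ γ : M.Elem} {X Y Z : M.Elem → H} {q : H}

theorem subMem_Share_le_point (hZ : CBLike τ Z) (α : M.Elem) (i n : ℕ) :
    M.subMem (M.Share Z) α i ≤ ⨆ δ, ⨆ l, (valid τ l ⊓ M.passes δ (initial (pointFn l) n)) ⊓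
      ⨅ w, M.passes δ w ⇨ M.val α (pairJ i (seqCode w)) 0 := by
  refine (subMem_Share_le Z α i).trans (iSup_mono fun δ => ?_)
  rw [← iSup_inf_eq]
  exact inf_le_inf_right _ (hZ.le_point δ n)

theorem exists_of_inf_reduces_ne_bot (h : q ⊓ M.reduces X Y ≠ ⊥) : ∃ q' ≤ q, q' ≠ ⊥ ∧ ∃ γ,
    q' ≤ M.isFun γ ∧ (∀ β, q' ⊓ X β ≤ M.imageMem Y γ β) ∧ ∀ β, q' ⊓ M.imageMem Y γ β ≤ X β := by
  obtain ⟨γ, hγ⟩ := exists_inf_ne_bot h inf_le_right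
  refine ⟨_, inf_le_left.trans inf_le_left, hγ, γ, inf_le_right.trans inf_le_left,
    fun β => le_himp_iff.1 ?_, fun β => le_himp_iff.1 ?_⟩
  · exact inf_le_right.trans (inf_le_right.trans ((iInf_le _ β).trans inf_le_left))
  · exact inf_le_right.trans (inf_le_right.trans ((iInf_le _ β).trans inf_le_right))

theorem IsReduction.mono {q q' : H} {k : ℕ} {J : Fin k → Finset ℕ}
    (h : IsReduction q γ τ X Y J) (hq : q' ≤ q) : IsReduction q' γ τ X Y J :=
  { h with
    isFun := hq.trans h.isFun
    image := fun β => (inf_le_inf_right _ hq).trans (h.image β)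
    of_image := fun β => (inf_le_inf_right _ hq).trans (h.of_image β) }

theorem aliveAt_nil (x : ℕ × List ℕ) : aliveAt [] x := fun _ => rfl

/-- The target is a single conjunct with `n` components. Labelling the source roots by their
components gives `n + 1` labels against `n` target roots, so all target roots die and one source
root survives. With every conjunct already in `V`, a new kill is absurd. -/
theorem le_disjProductive (hM : M.AC00) (hBCP : M.BCP) (hτ : q ≤ isSumStump σ τ)
    (hacc : q ≤ HAcc (treeRel τ) []) (hZ : CBLike τ Z) : q ≤ M.disjProductive (M.Share Z) := by
  refine le_iInf fun n => ?_
  rw [le_compl_iff_disjoint_right, disjoint_iff]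
  by_contra hne
  obtain ⟨q₀, hq₀, hb, γ, hfun, himage, hof⟩ := exists_of_inf_reduces_ne_bot hne
  have hmem : ∀ {m} {i : ℕ} (hi : i < m) (β : M.Elem) (s : List ℕ),
      valid τ s ⊓ alive β (i, s) ≤ M.disj m (M.Share Z) β := fun hi β s =>
    (alive_le_subMem hM hZ β (_, s)).trans
      (le_iSup (fun j : Fin _ => M.subMem (M.Share Z) β j) ⟨_, hi⟩)
  have hred : IsReduction q₀ γ τ (M.disj (n + 1) (M.Share Z)) (M.disj n (M.Share Z))
      (fun _ : Fin 1 => Finset.range n) := by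
    refine ⟨hfun, himage, hof, fun d hd β => (iInf_le _ 0).trans ?_, fun j η m => ?_⟩
    · exact hmem (Finset.mem_range.1 (hd 0)) β (d 0).2
    · exact iSup_le fun i => le_iSup_of_le i (le_iSup_of_le (Finset.mem_range.2 i.2)
        (subMem_Share_le_point hZ η i m))
  have hX : ∀ β, M.disj (n + 1) (M.Share Z) β ≤ ⨆ i, ⨆ _ : i ∈ Set.Iio (n + 1), ⨆ δ,
      ⨅ w, M.passes δ w ⇨ M.val β (pairJ i (seqCode w)) 0 := fun β =>
    iSup_le fun i => le_iSup_of_le (i : ℕ) (le_iSup_of_le i.2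
      ((subMem_Share_le Z β i).trans (iSup_mono fun δ => inf_le_right)))
  set A : Finset (ℕ × List ℕ) := (Finset.range (n + 1)).image fun i => (i, [])
  have himg : A.image Prod.fst = Finset.range (n + 1) := by
    simp [A, Finset.image_image, Function.comp_def]
  obtain ⟨q₁, hq₁, hb₁, u, -, t, ht, j, n₀, hA, -, hd⟩ := exists_forall_dead (lab := Prod.fst)
    (B := ∅) (I := Set.Iio (n + 1)) hM hBCP hb hfun hof hX
    (fun _ : Fin 1 => (List.range n).map fun i => (i, []))
    (fun d hd β => by
      obtain ⟨i, hi, he⟩ := List.mem_map.1 (hd 0)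
      have := hmem (List.mem_range.1 hi) β []
      rw [he, valid_nil, top_inf_eq] at this
      exact (inf_le_right.trans (iInf_le _ 0)).trans this)
    A (by simp) [] (fun x _ => aliveAt_nil x) (by simp) (by rw [himg]; simp)
  rw [himg] at ht
  obtain ⟨_, _, _, _, _, _, _, j, hj, _⟩ := (hred.mono hq₁).newKill (σ := σ) (V := Finset.univ) (i₀ := t)
    (B := ∅) (cU := 0) (u := u) (n₀ := n₀) hM hBCP ((hq₁.trans hq₀).trans hτ)
    ((hq₁.trans hq₀).trans hacc) hX
    (fun s β => by
      refine le_trans ?_ (hmem (Finset.mem_range.1 ht) β s)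
      exact inf_le_left.trans (inf_le_inf_right _ inf_le_right))
    (by simp) (by simp) hb₁
    (fun _ _ i hi => hd (i, []) (List.mem_map.2 ⟨i, List.mem_range.2 (Finset.mem_range.1 hi), rfl⟩))
    (by simp) (hA (t, []) (Finset.mem_image.2 ⟨t, ht, rfl⟩) rfl)
  exact hj (Finset.mem_univ j)

/-- Each target component is a conjunct of its own, and `V` collects those with dead roots. The
source component with number `V.card` is active: it is used to kill the next target root. The lower
ones keep a surviving point and the higher ones their roots. Every round enlarges `V`, but a subset
of `Fin n` cannot grow beyond `n` elements. -/
theorem not_isReduction_conj (hM : M.AC00) (hBCP : M.BCP) (hτ : q ≤ isSumStump σ τ)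
    (hacc : q ≤ HAcc (treeRel τ) []) (hZ : CBLike τ Z) (hq : q ≠ ⊥) {n : ℕ} {γ : M.Elem}
    (hred : IsReduction q γ τ (M.conj (n + 1) (M.Share Z)) (M.conj n (M.Share Z))
      (fun j : Fin n => {(j : ℕ)})) (V : Finset (Fin n)) (B : Finset (ℕ × List ℕ))
    (hBV : ∀ x ∈ B, x.1 ≠ V.card) {u : List ℕ} {n₀ : ℕ} (hB : ∀ x ∈ B, aliveAt u x)
    (hB' : ∀ i ≤ n, i ≠ V.card → ∃ s, (i, s) ∈ B ∧ q ≤ valid τ s)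
    (hBnil : ∀ i ≤ n, V.card < i → (i, []) ∈ B)
    (hu : aliveAt u (V.card, [])) (hdead : ∀ j ∈ V, dead γ n₀ q u (j, [])) : False := by
  classical
  induction hm : n - V.card using Nat.strong_induction_on generalizing q V B u n₀ with
  | _ m ih =>
  have hX : ∀ i ≤ n, ∀ β, M.conj (n + 1) (M.Share Z) β ≤ M.subMem (M.Share Z) β i :=
    fun i hi β => iInf_le (fun j : Fin (n + 1) => M.subMem (M.Share Z) β j)
      ⟨i, Nat.lt_succ_of_le hi⟩
  have hVn : V.card ≤ n := by simpa using Finset.card_le_univ V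
  obtain ⟨q', hq', hb', u', hu', hBu', ⟨s, hs, hsu⟩, j, hj, n₁, hd⟩ := hred.newKill (σ := σ)
    (V := V) (I := {V.card}) (i₀ := V.card) (B := B) (cU := fun j => j) (u := u) (n₀ := n₀)
    hM hBCP hτ hacc
    (fun β => le_iSup_of_le V.card (le_iSup_of_le rfl ((hX _ hVn β).trans
      ((subMem_Share_le Z β _).trans (iSup_mono fun δ => inf_le_right)))))
    (fun s β => le_iInf fun i => by
      by_cases hi : (i : ℕ) = V.card
      · rw [hi]
        refine le_trans (inf_le_left.trans (inf_le_inf_right _ inf_le_right))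
          (alive_le_subMem hM hZ β (V.card, s))
      · obtain ⟨s', hs', hv⟩ := hB' i (Nat.lt_succ_iff.1 i.2) hi
        refine le_trans (le_inf ?_ ?_) (alive_le_subMem hM hZ β (i, s'))
        · exact (inf_le_left.trans (inf_le_left.trans inf_le_left)).trans hv
        · exact inf_le_right.trans (iInf₂_le (f := fun x (_ : x ∈ B) => alive β x) _ hs'))
    (fun x hx => hBV x hx) (fun j _ => Finset.mem_singleton_self _) hq
    (fun j hj i hi => (Finset.mem_singleton.1 hi) ▸ hdead j hj) hB hu
  have hcard : (insert j V).card = V.card + 1 := Finset.card_insert_of_notMem hj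
  have hlt : V.card + 1 ≤ n := by
    simpa [hcard] using Finset.card_le_univ (insert j V)
  refine ih (n - (insert j V).card) (by omega) (q := q') (V := insert j V)
    -- The component just used is frozen at its surviving point; the next one becomes active, so its
    -- points leave `B`.
    (B := insert (V.card, s) (B.filter fun x => x.1 ≠ V.card + 1)) (u := u') (n₀ := max n₀ n₁)
    (hq'.trans hτ) (hq'.trans hacc) hb' (hred.mono hq') ?_ ?_ ?_ ?_ ?_ ?_ rfl
  · intro x hx
    rw [hcard]
    rcases Finset.mem_insert.1 hx with rfl | hx
    · simp
    · exact (Finset.mem_filter.1 hx).2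
  · intro x hx
    rcases Finset.mem_insert.1 hx with rfl | hx
    · exact hsu
    · exact hBu' x (Finset.mem_filter.1 hx).1
  · intro i hi hne
    rw [hcard] at hne
    by_cases hiV : i = V.card
    · subst hiV
      exact ⟨s, Finset.mem_insert_self _ _, hs⟩
    · obtain ⟨s', hs', hv⟩ := hB' i hi hiV
      exact ⟨s', Finset.mem_insert_of_mem (Finset.mem_filter.2 ⟨hs', hne⟩), hq'.trans hv⟩
  · intro i hi hlt'
    rw [hcard] at hlt'
    exact Finset.mem_insert_of_mem (Finset.mem_filter.2 ⟨hBnil i hi (by omega), by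
      simp only [ne_eq]; omega⟩)
  · rw [hcard]
    exact hBu' _ (hBnil _ hlt (by omega))
  · intro i hi
    rcases Finset.mem_insert.1 hi with rfl | hi
    · exact dead_mono hd (le_max_right _ _) le_rfl List.prefix_rfl
    · exact dead_mono (hdead i hi) (le_max_left _ _) hq' hu'

theorem le_conjProductive (hM : M.AC00) (hBCP : M.BCP) (hτ : q ≤ isSumStump σ τ)
    (hacc : q ≤ HAcc (treeRel τ) []) (hZ : CBLike τ Z) : q ≤ M.conjProductive (M.Share Z) := by
  refine le_iInf fun n => ?_
  rw [le_compl_iff_disjoint_right, disjoint_iff]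
  by_contra hne
  obtain ⟨q₀, hq₀, hb, γ, hfun, himage, hof⟩ := exists_of_inf_reduces_ne_bot hne
  have hred : IsReduction q₀ γ τ (M.conj (n + 1) (M.Share Z)) (M.conj n (M.Share Z))
      (fun j : Fin n => {(j : ℕ)}) := by
    refine ⟨hfun, himage, hof, fun d hd β => iInf_mono fun j => ?_, fun j η m => ?_⟩
    · rw [← Finset.mem_singleton.1 (hd j)]
      exact alive_le_subMem hM hZ β (d j)
    · exact (iInf_le _ j).trans (le_iSup_of_le (j : ℕ) (le_iSup_of_le
        (Finset.mem_singleton_self _) (subMem_Share_le_point hZ η j m)))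
  refine not_isReduction_conj hM hBCP (hq₀.trans hτ) (hq₀.trans hacc) hZ hb hred ∅
    ((Finset.Icc 1 n).image fun i => (i, [])) ?_ (n₀ := 0) (fun x _ => aliveAt_nil x) ?_ ?_
    (aliveAt_nil _) (by simp)
  · intro x hx
    obtain ⟨i, hi, rfl⟩ := Finset.mem_image.1 hx
    have := (Finset.mem_Icc.1 hi).1
    simp only [Finset.card_empty]
    omega
  · intro i hi hne
    rw [Finset.card_empty] at hne
    exact ⟨[], Finset.mem_image_of_mem _ (Finset.mem_Icc.2 ⟨by omega, hi⟩), by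
      rw [valid_nil]; exact le_top⟩
  · intro i hi hlt
    exact Finset.mem_image_of_mem _ (Finset.mem_Icc.2 ⟨hlt, hi⟩)

end

end BaireInterp

theorem mainTheorem8 {H : Type u} [Order.Frame H] (M : BaireInterp.{u, v} H)
    (hM : M.IsBrouwerian) :
    (⨅ σ, M.Stp σ ⇨ ⨆ τ, M.Stp τ ⊓ M.lt σ τ ⊓
      (M.disjProductive (M.Share (M.CB τ)) ⊓ M.conjProductive (M.Share (M.CB τ))) ⊓
      (M.disjProductive (M.Share (M.cl (M.CB τ))) ⊓
        M.conjProductive (M.Share (M.cl (M.CB τ))))) = ⊤ := by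
  open BaireInterp in
  rw [← top_le_iff]
  refine le_iInf fun σ => le_himp_iff.2 (inf_le_right.trans ?_)
  refine iSup_elim (le_top.trans (iSup_isSumStump hM.ac00 σ).ge) fun τ q hq hτ => ?_
  have hσ : q ≤ HAcc (treeRel σ) [] := hq.trans (Stp_le_HAcc σ)
  have hacc : q ≤ HAcc (treeRel τ) [] := HAcc_sumStump hτ hσ
  have hCB := CBLike_CB hM.ac00 τ
  have hcl := CBLike_cl hM.ac00 τ
  refine le_iSup_of_le τ (le_inf (le_inf (le_inf (hacc.trans (HAcc_le_Stp hM.ac00 τ))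
    (le_sumStump hτ hM.ac00 hσ)) (le_inf ?_ ?_)) (le_inf ?_ ?_))
  · exact le_disjProductive hM.ac00 hM.bcp hτ hacc hCB
  · exact le_conjProductive hM.ac00 hM.bcp hτ hacc hCB
  · exact le_disjProductive hM.ac00 hM.bcp hτ hacc hcl
  · exact le_conjProductive hM.ac00 hM.bcp hτ hacc hcl
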